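/- Write $D_0=\mathbb{C}\setminus\left(\mathrm{i}[2\pi,+\infty)\cup \mathrm{i}(-\infty,-2\pi]\right)$ and $\tfrac12 D_0=\{z\in\mathbb{C} : 2z\in D_0\}$, and let $\phi$ be the holomorphic function on $D_0$ given by $\phi(z)=\log\left(\frac{\sinh (z/2)}{z/2}\right)$, $\phi(0)=0$; that is, $\phi(z)=\int_0^1 z\,\phi'(tz)\,dt$ with $\phi'(z)=\frac12\coth\frac z2-\frac1z$ (and $\phi'(0)=0$). The Thoma simplex $\Omega$ is the set of pairs $\omega=(\alpha,\beta)$ of sequences $\alpha_1\ge\alpha_2\ge\cdots\ge0$, $\beta_1\ge\beta_2\ge\cdots\ge 0$ with $\sum_i(\alpha_i+\beta_i)\le 1$. To $\omega\in\Omega$ one associates the probability measure on $[-1,1]$ $$\mu_\omega=\sum_i\alpha_i\,\delta_{\alpha_i}+\sum_i\beta_i\,\delta_{-\beta_i}+\Bigl(1-\sum_i(\alpha_i+\beta_i)\Bigr)\delta_0$$ and, for $z\in\frac12D_0$, $$\Lambda_\omega(z)=\int_0^1\int_{-1}^1\bigl(\phi(tz)-\phi(txz)\bigr)\,\mu_\omega(dx)\,dt,$$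 $$\Psi_\omega(z)=\frac12\int_{-1}^1\int_{-1}^1\left(\phi(z)+\frac{\phi((y-x)z)-\phi(yz)-\phi(-xz)}{xy}\right)\mu_\omega^{\otimes2}(dx\,dy),$$ where the quotient is extended by continuity to $xy=0$. If $\lambda$ is a partition of $n\ge1$ with conjugate $\lambda'$, whose Young diagram has $d$ diagonal cells, its Thoma parameter $\omega_\lambda$ is given by $\alpha_i=\frac1n(\lambda_i-i+\frac12)$ and $\beta_i=\frac1n(\lambda'_i-i+\frac12)$ for $1\le i\le d$, and $\alpha_i=\beta_i=0$ for $i>d$. A standard tableau $T$ of shape $\lambda$ is a bijective numbering of the cells of the Young diagram of $\lambda$ by $1,\dots,n$ which increases strictly along rows and columns; $\mathrm{maj}(T)$ is the sum of the descents of $T$, i.e. of those $i\in\{1,\dots,n-1\}$ such that $i+1$ lies in a row of strictly larger index than the row of $i$. A growing sequence is a sequence of partitions $(\lambda^{(n)})_{n\ge1}$ with $|\lambda^{(n)}|=n$. For such a sequence let $T^{(n)}$ be a uniformly random standard tableau of shape $\lambda^{(n)}$, $X^{(n)}=\mathrm{maj}(T^{(n)})/n$ and $\omega^{(n)}=\omega_{\lambda^{(n)}}$.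 **Theorem A.** For every growing sequence and every $n\ge1$, there is a holomorphic function $z\mapsto\log\mathbb{E}[e^{z(X^{(n)}-\mathbb{E}X^{(n)})}]$ on $\frac12D_0$ which vanishes at $0$ and whose exponential is $\mathbb{E}[e^{z(X^{(n)}-\mathbb{E}X^{(n)})}]$ (it is unique, as $\frac12D_0$ is connected), and $$\log\mathbb{E}\left[e^{z(X^{(n)}-\mathbb{E}[X^{(n)}])}\right]=n\,\Lambda_{\omega^{(n)}}(z)+\Psi_{\omega^{(n)}}(z)+o(1),$$ where the remainder $o(1)$ goes to $0$ uniformly over all growing sequences and uniformly on compact subsets of $\frac12D_0$: for every compact $K\subset\frac12D_0$ and every $\varepsilon>0$ there is $N\ge1$ such that, for every growing sequence, every $n\ge N$ and every $z\in K$, the remainder has modulus smaller than $\varepsilon$. -/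

import Mathlib

open MeasureTheory Filter Topology
open scoped BigOperators

noncomputable section

/-! ### Standard tableaux and the major index

A partition is given by its Young diagram (Mathlib's `YoungDiagram`): the cell `(i, j)` is the cell
in row `i` and column `j`, both numbered from `0`, and `lam.card` is the size of the partition. -/

/-- Standard tableaux of shape `lam`: bijective numberings of the `n` cells of `lam` by `1, …, n`
(stored as `0, …, n - 1`) which are strictly increasing along the rows and along the columns. -/
def StandardTableau (lam : YoungDiagram) : Type :=
  {e : {c : ℕ × ℕ // c ∈ lam.cells} ≃ Fin lam.card //
    (∀ c c', c.1.1 = c'.1.1 → c.1.2 < c'.1.2 → e c < e c') ∧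
    (∀ c c', c.1.2 = c'.1.2 → c.1.1 < c'.1.1 → e c < e c')}

instance instFiniteStandardTableau (lam : YoungDiagram) : Finite (StandardTableau lam) := by
  unfold StandardTableau
  infer_instance

instance instFintypeStandardTableau (lam : YoungDiagram) : Fintype (StandardTableau lam) :=
  Fintype.ofFinite _

/-- The label in `1, …, n` of the cell `c` in the standard tableau `T`. -/
def StandardTableau.label {lam : YoungDiagram} (T : StandardTableau lam)
    (c : {c : ℕ × ℕ // c ∈ lam.cells}) : ℕ :=
  (T.1 c : ℕ) + 1

/-- `i` is a descent of `T` if `i + 1` appears in a row strictly above the row containing `i`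
(French convention: rows with larger index are drawn above rows with smaller index). -/
def StandardTableau.IsDescent {lam : YoungDiagram} (T : StandardTableau lam) (i : ℕ) : Prop :=
  ∃ c c' : {c : ℕ × ℕ // c ∈ lam.cells},
    T.label c = i ∧ T.label c' = i + 1 ∧ c.1.1 < c'.1.1

open Classical in
/-- The major index: the sum of the descents. -/
def StandardTableau.maj {lam : YoungDiagram} (T : StandardTableau lam) : ℕ :=
  ∑ i ∈ (Finset.Icc 1 (lam.card - 1)).filter (fun i => T.IsDescent i), i

/-- The random variable `X = maj(T) / n`, with `n` the size of the shape of `T`. -/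
def StandardTableau.X {lam : YoungDiagram} (T : StandardTableau lam) : ℝ :=
  (T.maj : ℝ) / (lam.card : ℝ)

/-- The expectation `𝔼[X]` for `T` uniform among the standard tableaux of shape `lam`. -/
def meanX (lam : YoungDiagram) : ℝ :=
  (∑ T : StandardTableau lam, T.X) / (Fintype.card (StandardTableau lam) : ℝ)

/-- The Laplace transform `𝔼[exp (z (X - 𝔼[X]))]` of the centered variable, for `T` uniform among
the standard tableaux of shape `lam` and `z` complex. -/
def centeredLaplace (lam : YoungDiagram) (z : ℂ) : ℂ :=
  (∑ T : StandardTableau lam, Complex.exp (z * ((T.X - meanX lam : ℝ) : ℂ))) /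
    (Fintype.card (StandardTableau lam) : ℂ)

/-- Growing sequences of partitions: the `n`-th partition has size `n`, for `n ≥ 1`. -/
def IsGrowing (lam : ℕ → YoungDiagram) : Prop :=
  ∀ n : ℕ, 1 ≤ n → (lam n).card = n

/-! ### The Thoma simplex and its probability measures -/

/-- The Thoma simplex `Ω`. -/
structure ThomaParam where
  /-- the sequence `α₁ ≥ α₂ ≥ ⋯ ≥ 0` -/
  α : ℕ → ℝ
  /-- the sequence `β₁ ≥ β₂ ≥ ⋯ ≥ 0` -/
  β : ℕ → ℝ
  α_anti : Antitone α
  β_anti : Antitone β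
  α_nonneg : ∀ i, 0 ≤ α i
  β_nonneg : ∀ i, 0 ≤ β i
  summable : Summable (fun i => α i + β i)
  tsum_le_one : ∑' i, (α i + β i) ≤ 1

/-- The probability measure `μ_ω = ∑ α_i δ_{α_i} + ∑ β_i δ_{-β_i} + γ δ_0`, where
`γ = 1 - ∑ (α_i + β_i)`; it is a measure on `ℝ` carried by `[-1, 1]`. -/
def thomaMeasure (ω : ThomaParam) : Measure ℝ :=
  Measure.sum (fun i => ENNReal.ofReal (ω.α i) • Measure.dirac (ω.α i)) +
  Measure.sum (fun i => ENNReal.ofReal (ω.β i) • Measure.dirac (-(ω.β i))) +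
  ENNReal.ofReal (1 - ∑' i, (ω.α i + ω.β i)) • Measure.dirac (0 : ℝ)

/-- The Frobenius coordinate `a_{i+1} = λ_{i+1} - (i+1) + 1/2` of the partition, extended by `0`
beyond the diagonal of the diagram. -/
def frobA (lam : YoungDiagram) (i : ℕ) : ℝ :=
  if (i, i) ∈ lam then (lam.rowLen i : ℝ) - ((i : ℝ) + 1) + 1 / 2 else 0

/-- The Frobenius coordinate `b_{i+1} = λ'_{i+1} - (i+1) + 1/2` of the partition, extended by `0`
beyond the diagonal of the diagram. -/
def frobB (lam : YoungDiagram) (i : ℕ) : ℝ :=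
  if (i, i) ∈ lam then (lam.colLen i : ℝ) - ((i : ℝ) + 1) + 1 / 2 else 0

theorem frobA_nonneg (lam : YoungDiagram) (i : ℕ) : 0 ≤ frobA lam i := by
  unfold frobA
  split_ifs with h
  · have h1 : i + 1 ≤ lam.rowLen i := YoungDiagram.mem_iff_lt_rowLen.1 h
    have h2 : (i : ℝ) + 1 ≤ lam.rowLen i := by exact_mod_cast h1
    linarith
  · exact le_rfl

theorem frobB_nonneg (lam : YoungDiagram) (i : ℕ) : 0 ≤ frobB lam i := by
  unfold frobB
  split_ifs with h
  · have h1 : i + 1 ≤ lam.colLen i := YoungDiagram.mem_iff_lt_colLen.1 h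
    have h2 : (i : ℝ) + 1 ≤ lam.colLen i := by exact_mod_cast h1
    linarith
  · exact le_rfl

theorem frobA_antitone (lam : YoungDiagram) : Antitone (frobA lam) := by
  intro i j hij
  by_cases hj : (j, j) ∈ lam
  · have hi : (i, i) ∈ lam := lam.up_left_mem hij hij hj
    have h1 : (lam.rowLen j : ℝ) ≤ lam.rowLen i := by exact_mod_cast lam.rowLen_anti i j hij
    have h2 : (i : ℝ) ≤ j := by exact_mod_cast hij
    simp only [frobA, hi, hj, if_true]
    linarith
  · have h0 : frobA lam j = 0 := by simp [frobA, hj]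
    rw [h0]
    exact frobA_nonneg lam i

theorem frobB_antitone (lam : YoungDiagram) : Antitone (frobB lam) := by
  intro i j hij
  by_cases hj : (j, j) ∈ lam
  · have hi : (i, i) ∈ lam := lam.up_left_mem hij hij hj
    have h1 : (lam.colLen j : ℝ) ≤ lam.colLen i := by exact_mod_cast lam.colLen_anti i j hij
    have h2 : (i : ℝ) ≤ j := by exact_mod_cast hij
    simp only [frobB, hi, hj, if_true]
    linarith
  · have h0 : frobB lam j = 0 := by simp [frobB, hj]
    rw [h0]
    exact frobB_nonneg lam i

theorem frob_eq_zero_of_le (lam : YoungDiagram) (i : ℕ) (hi : lam.rowLen 0 ≤ i) :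
    frobA lam i = 0 ∧ frobB lam i = 0 := by
  have h : (i, i) ∉ lam := by
    intro h
    have h1 : (0, i) ∈ lam := lam.up_left_mem (Nat.zero_le i) le_rfl h
    have h2 := YoungDiagram.mem_iff_lt_rowLen.1 h1
    omega
  simp [frobA, frobB, h]

theorem card_hook (lam : YoungDiagram) (k : ℕ) :
    ((lam.cells.filter (fun c => min c.1 c.2 = k)).card : ℝ) = frobA lam k + frobB lam k := by
  by_cases hk : (k, k) ∈ lam
  · have hr : k < lam.rowLen k := YoungDiagram.mem_iff_lt_rowLen.1 hk
    have hc : k < lam.colLen k := YoungDiagram.mem_iff_lt_colLen.1 hk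
    have key : lam.cells.filter (fun c => min c.1 c.2 = k) =
        ({k} ×ˢ Finset.Ico k (lam.rowLen k)) ∪ (Finset.Ico (k + 1) (lam.colLen k) ×ˢ {k}) := by
      ext ⟨i, j⟩
      simp only [Finset.mem_filter, YoungDiagram.mem_cells, Finset.mem_union, Finset.mem_product,
        Finset.mem_singleton, Finset.mem_Ico]
      constructor
      · rintro ⟨hm, hmin⟩
        rcases le_or_gt i j with hij | hij
        · rw [min_eq_left hij] at hmin
          subst hmin
          exact Or.inl ⟨rfl, hij, YoungDiagram.mem_iff_lt_rowLen.1 hm⟩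
        · rw [min_eq_right hij.le] at hmin
          subst hmin
          exact Or.inr ⟨⟨hij, YoungDiagram.mem_iff_lt_colLen.1 hm⟩, rfl⟩
      · rintro (⟨rfl, h1, h2⟩ | ⟨⟨h1, h2⟩, rfl⟩)
        · exact ⟨YoungDiagram.mem_iff_lt_rowLen.2 h2, min_eq_left h1⟩
        · exact ⟨YoungDiagram.mem_iff_lt_colLen.2 h2, min_eq_right (by omega)⟩
    have hdisj : Disjoint (({k} : Finset ℕ) ×ˢ Finset.Ico k (lam.rowLen k))
        (Finset.Ico (k + 1) (lam.colLen k) ×ˢ ({k} : Finset ℕ)) := by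
      rw [Finset.disjoint_left]
      rintro ⟨i, j⟩ h1 h2
      simp only [Finset.mem_product, Finset.mem_singleton, Finset.mem_Ico] at h1 h2
      omega
    rw [key, Finset.card_union_of_disjoint hdisj, Finset.card_product, Finset.card_product]
    simp only [Finset.card_singleton, Nat.card_Ico, one_mul, mul_one, frobA, frobB, hk, if_true]
    rw [Nat.cast_add, Nat.cast_sub hr.le, Nat.cast_sub (show k + 1 ≤ lam.colLen k from hc)]
    push_cast
    ring
  · have key : lam.cells.filter (fun c => min c.1 c.2 = k) = ∅ := by
      rw [Finset.filter_eq_empty_iff]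
      rintro ⟨i, j⟩ hm hmin
      rw [YoungDiagram.mem_cells] at hm
      simp only at hmin
      exact hk (lam.up_left_mem (by omega) (by omega) hm)
    simp [key, frobA, frobB, hk]

/-- The Frobenius coordinates of a partition sum up to its size. -/
theorem sum_frob (lam : YoungDiagram) :
    ∑ k ∈ Finset.range (lam.rowLen 0), (frobA lam k + frobB lam k) = (lam.card : ℝ) := by
  have h : ∀ c ∈ lam.cells, min c.1 c.2 ∈ Finset.range (lam.rowLen 0) := by
    rintro ⟨i, j⟩ hm
    rw [YoungDiagram.mem_cells] at hm
    have h1 : (0, j) ∈ lam := lam.up_left_mem (Nat.zero_le i) le_rfl hm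
    have h2 := YoungDiagram.mem_iff_lt_rowLen.1 h1
    rw [Finset.mem_range]
    exact lt_of_le_of_lt (min_le_right _ _) h2
  have h3 := Finset.card_eq_sum_card_fiberwise (f := fun c : ℕ × ℕ => min c.1 c.2) h
  have h4 : (lam.card : ℝ) = ((∑ k ∈ Finset.range (lam.rowLen 0),
      (lam.cells.filter (fun c => min c.1 c.2 = k)).card : ℕ) : ℝ) := by
    exact_mod_cast h3
  rw [h4, Nat.cast_sum]
  exact Finset.sum_congr rfl fun k _ => (card_hook lam k).symm

theorem hasSum_frob (lam : YoungDiagram) :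
    HasSum (fun i => frobA lam i / (lam.card : ℝ) + frobB lam i / (lam.card : ℝ))
      ((lam.card : ℝ) / (lam.card : ℝ)) := by
  have h : ∑ k ∈ Finset.range (lam.rowLen 0),
      (frobA lam k / (lam.card : ℝ) + frobB lam k / (lam.card : ℝ)) =
        (lam.card : ℝ) / (lam.card : ℝ) := by
    rw [← sum_frob lam, Finset.sum_div]
    exact Finset.sum_congr rfl fun k _ => (add_div _ _ _).symm
  rw [← h]
  apply hasSum_sum_of_ne_finset_zero
  intro i hi
  rw [Finset.mem_range, not_lt] at hi
  obtain ⟨h1, h2⟩ := frob_eq_zero_of_le lam i hi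
  simp [h1, h2]

/-- The Thoma parameter `ω_λ` of a partition: its Frobenius coordinates divided by its size. -/
def thomaOf (lam : YoungDiagram) : ThomaParam where
  α := fun i => frobA lam i / (lam.card : ℝ)
  β := fun i => frobB lam i / (lam.card : ℝ)
  α_anti := fun _ _ h => div_le_div_of_nonneg_right (frobA_antitone lam h) (Nat.cast_nonneg _)
  β_anti := fun _ _ h => div_le_div_of_nonneg_right (frobB_antitone lam h) (Nat.cast_nonneg _)
  α_nonneg := fun i => div_nonneg (frobA_nonneg lam i) (Nat.cast_nonneg _)
  β_nonneg := fun i => div_nonneg (frobB_nonneg lam i) (Nat.cast_nonneg _)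
  summable := (hasSum_frob lam).summable
  tsum_le_one := by
    rw [(hasSum_frob lam).tsum_eq]
    exact div_self_le_one _

/-! ### The function `φ` and the functions `Λ_ω`, `Ψ_ω` -/

/-- The domain `D₀ = ℂ \ (i[2π, ∞) ∪ i(-∞, -2π])`. -/
def D0 : Set ℂ := {z | ¬ (z.re = 0 ∧ 2 * Real.pi ≤ |z.im|)}

/-- The domain `½ D₀`. -/
def halfD0 : Set ℂ := {z | 2 * z ∈ D0}

/-- The derivative `φ'(z) = ½ coth (z/2) - 1/z` of `φ(z) = log (sinh (z/2) / (z/2))`, with its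
removable singularity at `0` removed. -/
def phiDeriv (z : ℂ) : ℂ :=
  if z = 0 then 0 else (1 / 2) * (Complex.cosh (z / 2) / Complex.sinh (z / 2)) - 1 / z

/-- The function `φ(z) = log (sinh (z/2) / (z/2))` on the star-shaped domain `D₀`, for the
holomorphic branch with `φ(0) = 0`: the integral of `φ'` along the segment from `0` to `z`. -/
def phi (z : ℂ) : ℂ :=
  ∫ t in (0 : ℝ)..1, z * phiDeriv ((t : ℂ) * z)

/-- `Λ_ω(z) = ∫_{t=0}^1 ∫_x (φ(tz) - φ(txz)) μ_ω(dx) dt`. -/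
def Lam (ω : ThomaParam) (z : ℂ) : ℂ :=
  ∫ t in (0 : ℝ)..1, ∫ x : ℝ,
    (phi ((t : ℂ) * z) - phi ((t : ℂ) * (x : ℂ) * z)) ∂(thomaMeasure ω)

/-- The function `(φ((y - x)z) - φ(yz) - φ(-xz)) / (xy)`, extended by continuity to `xy = 0`
(recall that `φ'' (0) = 1/12`). -/
def psiKernel (z : ℂ) (x y : ℝ) : ℂ :=
  if x = 0 then
    (if y = 0 then -(z ^ 2 / 12) else -(z * phiDeriv ((y : ℂ) * z) / (y : ℂ)))
  else
    (if y = 0 then -(z * phiDeriv ((x : ℂ) * z) / (x : ℂ))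
    else (phi (((y : ℂ) - (x : ℂ)) * z) - phi ((y : ℂ) * z) - phi (-(x : ℂ) * z)) /
      ((x : ℂ) * (y : ℂ)))

/-- `Ψ_ω(z) = ½ ∫∫ (φ(z) + (φ((y-x)z) - φ(yz) - φ(-xz)) / (xy)) μ_ω^{⊗2}(dx dy)`. -/
def Psi (ω : ThomaParam) (z : ℂ) : ℂ :=
  (1 / 2) * ∫ p : ℝ × ℝ, (phi z + psiKernel z p.1 p.2)
    ∂((thomaMeasure ω).prod (thomaMeasure ω))

/-- `L` is, on the domain `U` containing `0`, the holomorphic logarithm of `F` which vanishes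
at `0`. -/
def IsHolomorphicLog (U : Set ℂ) (F L : ℂ → ℂ) : Prop :=
  DifferentiableOn ℂ L U ∧ L 0 = 0 ∧ ∀ z ∈ U, Complex.exp (L z) = F z

end

/-!
The generating function of the major index over the standard tableaux of shape `lam` has a product
formula (Stanley), which makes its Laplace transform explicit: writing `1 - q ^ k`, for
`q = exp (z / n)`, as a constant times `z * exp (k z / (2 n)) * exp (φ (k z / n))`, the logarithm of
the Laplace transform of the centered variable is
`∑_{k ≤ n} φ (k z / n) - ∑_c φ (h(c) z / n)`, where `h(c)` runs over the hook lengths. The factor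
`exp (c z)` left over needs no computation: as this sum is even in `z`, its derivative at `0`
vanishes, so `c` is the mean.

*The product formula.* Let `A_lam` be the generating function, and `A_lam^{≥ r}` its part coming from
the tableaux whose largest entry lies in a row of index at least `r`. Deleting the largest entry, in
the corner of row `s`, leaves a tableau of shape `mu`, and the position `n - 1` is a descent unless
the next largest entry lies in a row of index at least `s`; so this corner contributes
`q ^ (n - 1) A_mu + (1 - q ^ (n - 1)) A_mu^{≥ s}` (`majSumRow_of_corner`). With
`l_i = lam_i + k - i`, for `k` at least the number of rows, the determinants `mixedDet` obey the
same recursion: changing one row from terms to partial sums telescopes (`mixedDet_eq_add`), and the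
steps at rows without a corner vanish because two rows of the determinant agree
(`stepDet_eq_zero`). By induction on `n`, the generating
function is a quotient of two determinants, which are Vandermonde (`majSum_eq`).

*Frobenius coordinates.* The set of the `l_i` is the interval `[0, k)`, to which the
numbers `k + a` are added and from which the numbers `k - 1 - b` are removed, for the arms `a` and the
legs `b` of the diagonal cells. Expanding the quadratic expression in the indicator
function of this set gives the sum over the hook lengths in terms of arms and legs
(`betaEnergy_eq`). The identity of Laplace transforms is first obtained for `z > 0` and then extended
to `½ D₀` by the identity theorem (`exp_logLaplace`).

*The expansion.* The atoms `x` of the Thoma measure have mass `|x|` and are the Frobenius coordinates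
divided by `n`, so `n Λ + Ψ` is an explicit sum (`Lam_thomaOf`, `Psi_thomaOf`). Its double sums
are exactly those of the logarithm of the Laplace transform. What remains are differences between
Riemann sums over the multiples of `1 / n` and integrals up to a midpoint, each controlled by the
second derivative of `t ↦ φ (t z)` on `[0, 2]`; the Frobenius coordinates sum up to `n`, so the total
error is at most `5 M / n` (`norm_logLaplace_sub_le`), with `M` uniform on compact sets.
-/

noncomputable section

/-! ### The function `φ` -/

theorem StarConvex.real_mul_mem {U : Set ℂ} (hU : StarConvex ℝ 0 U) {z : ℂ} (hz : z ∈ U) {t : ℝ}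
    (ht : t ∈ Set.Icc (0 : ℝ) 1) : (t : ℂ) * z ∈ U := by
  have := hU hz (a := 1 - t) (b := t) (by linarith [ht.2]) ht.1 (by ring)
  simpa using this

/-- On an open set which is star-shaped at `0`, the integral of a holomorphic function along the
segments issued from `0` is a primitive. -/
theorem hasDerivAt_segmentIntegral {U : Set ℂ} (hUo : IsOpen U) (hU : StarConvex ℝ 0 U)
    {g : ℂ → ℂ} (hg : DifferentiableOn ℂ g U) {z : ℂ} (hz : z ∈ U) :
    HasDerivAt (fun w => ∫ t in (0 : ℝ)..1, w * g ((t : ℂ) * w)) (g z) z := by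
  have hg' : DifferentiableOn ℂ (deriv g) U := hg.deriv hUo
  have hat : ∀ w ∈ U, HasDerivAt g (deriv g w) w := fun w hw =>
    (hg.differentiableAt (hUo.mem_nhds hw)).hasDerivAt
  obtain ⟨r, hr, hball⟩ := Metric.nhds_basis_closedBall.mem_iff.1 (hUo.mem_nhds hz)
  set F' : ℂ → ℝ → ℂ := fun w t => g (t * w) + w * (t * deriv g (t * w)) with hF'
  have hmaps : Set.MapsTo (fun p : ℂ × ℝ => (p.2 : ℂ) * p.1)
      (Metric.closedBall z r ×ˢ Set.Icc (0 : ℝ) 1) U := fun p hp =>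
    hU.real_mul_mem (hball hp.1) hp.2
  have hc0 : ContinuousOn (fun p : ℂ × ℝ => (p.2 : ℂ) * p.1)
      (Metric.closedBall z r ×ˢ Set.Icc (0 : ℝ) 1) := by fun_prop
  have hcg := hg.continuousOn.comp hc0 hmaps
  have hcg' := hg'.continuousOn.comp hc0 hmaps
  have hcont : ContinuousOn (fun p : ℂ × ℝ => F' p.1 p.2)
      (Metric.closedBall z r ×ˢ Set.Icc (0 : ℝ) 1) := by
    have h1 : ContinuousOn (fun p : ℂ × ℝ => (p.2 : ℂ))
      (Metric.closedBall z r ×ˢ Set.Icc (0 : ℝ) 1) := by fun_prop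
    exact hcg.add (continuousOn_fst.mul (h1.mul hcg'))
  obtain ⟨C, hC⟩ := ((isCompact_closedBall z r).prod isCompact_Icc).exists_bound_of_continuousOn
    hcont
  have hsec : ∀ w ∈ Metric.closedBall z r, ContinuousOn (fun t : ℝ => w * g (t * w))
      (Set.uIcc (0 : ℝ) 1) := by
    intro w hw
    rw [Set.uIcc_of_le zero_le_one]
    exact continuousOn_const.mul (hcg.comp (f := fun t : ℝ => (w, t)) (by fun_prop)
      fun t ht => ⟨hw, ht⟩)
  have hsec' : ∀ w ∈ Metric.closedBall z r, ContinuousOn (F' w) (Set.uIcc (0 : ℝ) 1) := by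
    intro w hw
    rw [Set.uIcc_of_le zero_le_one]
    exact hcont.comp (f := fun t : ℝ => (w, t)) (by fun_prop) fun t ht => ⟨hw, ht⟩
  have hzr : z ∈ Metric.closedBall z r := Metric.mem_closedBall_self hr.le
  have hsub : Set.uIoc (0 : ℝ) 1 ⊆ Set.Icc 0 1 := by
    rw [Set.uIoc_of_le zero_le_one]; exact Set.Ioc_subset_Icc_self
  have key := intervalIntegral.hasDerivAt_integral_of_dominated_loc_of_deriv_le
    (μ := volume) (a := 0) (b := 1) (F := fun w (t : ℝ) => w * g (t * w)) (F' := F') (x₀ := z)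
    (bound := fun _ => C) (Metric.closedBall_mem_nhds z hr)
    (by
      filter_upwards [Metric.closedBall_mem_nhds z hr] with w hw
      exact (intervalIntegrable_iff.1 (hsec w hw).intervalIntegrable).aestronglyMeasurable)
    (hsec z hzr).intervalIntegrable
    (intervalIntegrable_iff.1 (hsec' z hzr).intervalIntegrable).aestronglyMeasurable
    (Eventually.of_forall fun t ht w hw => hC (w, t) ⟨hw, hsub ht⟩)
    intervalIntegrable_const
    (Eventually.of_forall fun t ht w hw => by
      have h1 := hat _ (hU.real_mul_mem (hball hw) (hsub ht))
      have h2 : HasDerivAt (fun w : ℂ => (t : ℂ) * w) t w := by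
        simpa using (hasDerivAt_id w).const_mul (t : ℂ)
      have h3 := (hasDerivAt_id w).mul (h1.comp w h2)
      refine h3.congr_deriv ?_
      simp only [hF', id, Function.comp]
      ring)
  -- the derivative of the integrand in `w` is the `t`-derivative of `t * g (t * z)`
  have hint : ∫ t in (0 : ℝ)..1, F' z t = g z := by
    have h := intervalIntegral.integral_eq_sub_of_hasDerivAt (a := (0 : ℝ)) (b := 1)
      (f := fun t : ℝ => (t : ℂ) * g (t * z)) (f' := F' z)
      (fun t ht => by
        rw [Set.uIcc_of_le zero_le_one] at ht
        have h1 := hat _ (hU.real_mul_mem hz ht)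
        have h2 : HasDerivAt (fun t : ℝ => (t : ℂ)) 1 t := Complex.ofRealCLM.hasDerivAt
        have h2' : HasDerivAt (fun t : ℝ => (t : ℂ) * z) z t := by simpa using h2.mul_const z
        have h3 := h2.mul (h1.comp t h2')
        refine h3.congr_deriv ?_
        simp only [hF', Function.comp]
        ring)
      (hsec' z hzr).intervalIntegrable
    simpa using h
  rw [← hint]
  exact key.2

theorem isOpen_D0 : IsOpen D0 := by
  have : D0 = {z : ℂ | z.re = 0 ∧ 2 * Real.pi ≤ |z.im|}ᶜ := rfl
  rw [this, isOpen_compl_iff]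
  exact (isClosed_eq Complex.continuous_re continuous_const).inter
    (isClosed_le continuous_const Complex.continuous_im.abs)

theorem starConvex_D0 : StarConvex ℝ 0 D0 := by
  rw [starConvex_zero_iff]
  intro z hz a ha0 ha1 h
  simp only [Complex.real_smul, Complex.mul_re, Complex.ofReal_re, Complex.ofReal_im, zero_mul,
    sub_zero, Complex.mul_im, add_zero, abs_mul, abs_of_nonneg ha0] at h
  obtain ⟨h1, h2⟩ := h
  have ha : a ≠ 0 := by
    rintro rfl
    linarith [Real.pi_pos]
  refine hz ⟨by simpa [ha] using h1, h2.trans ?_⟩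
  nlinarith [abs_nonneg z.im]

theorem zero_mem_D0 : (0 : ℂ) ∈ D0 := by
  simp [D0, Real.pi_pos]

theorem real_mul_mem_D0 {z : ℂ} (hz : z ∈ D0) {t : ℝ} (ht : |t| ≤ 1) : (t : ℂ) * z ∈ D0 := by
  rcases le_total 0 t with h | h
  · exact starConvex_D0.real_mul_mem hz ⟨h, (le_abs_self t).trans ht⟩
  · have h1 := starConvex_D0.real_mul_mem hz (t := -t) ⟨by linarith, (neg_le_abs t).trans ht⟩
    simpa [D0] using h1

theorem real_mul_mem_D0_of_halfD0 {z : ℂ} (hz : z ∈ halfD0) {t : ℝ} (ht : |t| ≤ 2) :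
    (t : ℂ) * z ∈ D0 := by
  have h := real_mul_mem_D0 (show 2 * z ∈ D0 from hz) (t := t / 2)
    (by rw [abs_div, abs_two]; linarith)
  have e : ((t / 2 : ℝ) : ℂ) * (2 * z) = t * z := by push_cast; ring
  rwa [e] at h

theorem ofReal_mem_D0 (x : ℝ) : (x : ℂ) ∈ D0 := by
  simp [D0, Real.pi_pos]

/-- The entire function `sinh (z / 2) / (z / 2)`, with value `1` at `0`. -/
def sinhc (z : ℂ) : ℂ := dslope Complex.sinh 0 (z / 2)

theorem sinhc_zero : sinhc 0 = 1 := by simp [sinhc, Complex.deriv_sinh]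

theorem sinhc_of_ne {z : ℂ} (hz : z ≠ 0) : sinhc z = Complex.sinh (z / 2) / (z / 2) := by
  rw [sinhc, dslope_of_ne _ (by simpa using hz), slope_def_field]
  simp

theorem differentiable_sinhc : Differentiable ℂ sinhc := by
  have h : Differentiable ℂ (dslope Complex.sinh 0) := by
    rw [← differentiableOn_univ, Complex.differentiableOn_dslope univ_mem]
    exact Complex.differentiable_sinh.differentiableOn
  exact h.comp (differentiable_id.div_const 2)

theorem sinhc_neg (z : ℂ) : sinhc (-z) = sinhc z := by
  by_cases hz : z = 0
  · simp [hz]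
  · rw [sinhc_of_ne hz, sinhc_of_ne (neg_ne_zero.2 hz), neg_div, Complex.sinh_neg, neg_div_neg_eq]

theorem sinhc_ne_zero {z : ℂ} (hz : z ∈ D0) : sinhc z ≠ 0 := by
  by_cases h0 : z = 0
  · rw [h0, sinhc_zero]; exact one_ne_zero
  · rw [sinhc_of_ne h0]
    refine div_ne_zero (fun h => ?_) (by simpa using h0)
    have hsin : Complex.sin (z / 2 * Complex.I) = 0 := by rw [Complex.sin_mul_I, h, zero_mul]
    obtain ⟨k, hk⟩ := Complex.sin_eq_zero_iff.1 hsin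
    have hz' : z = (2 * Real.pi * (-k : ℤ) : ℝ) * Complex.I := by
      push_cast
      linear_combination (-2 * Complex.I) * hk + z * Complex.I_sq
    have hk0 : k ≠ 0 := by
      rintro rfl
      exact h0 (by simpa using hz')
    apply hz
    rw [hz']
    have h1 : (1 : ℝ) ≤ |((-k : ℤ) : ℝ)| := by exact_mod_cast Int.one_le_abs (neg_ne_zero.2 hk0)
    refine ⟨by simp, ?_⟩
    simp only [Complex.mul_im, Complex.ofReal_re, Complex.I_im, mul_one, Complex.ofReal_im,
      Complex.I_re, mul_zero, add_zero, abs_mul, abs_two, abs_of_pos Real.pi_pos]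
    nlinarith [Real.pi_pos]

/-- `φ'` is the logarithmic derivative of `sinh (z / 2) / (z / 2)`. -/
theorem phiDeriv_eq {z : ℂ} (hz : z ∈ D0) : phiDeriv z = deriv sinhc z / sinhc z := by
  by_cases h0 : z = 0
  · have h1 : deriv sinhc 0 = 0 := by
      have h2 : (fun z => sinhc (-z)) = sinhc := funext sinhc_neg
      have h3 := deriv_comp_neg sinhc 0
      rw [h2, neg_zero] at h3
      linear_combination h3 / 2
    simp [h0, phiDeriv, h1]
  · have hs : Complex.sinh (z / 2) ≠ 0 := by
      have := sinhc_ne_zero hz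
      rw [sinhc_of_ne h0] at this
      exact fun h => this (by simp [h])
    have hd : HasDerivAt sinhc
        ((Complex.cosh (z / 2) * (1 / 2) * (z / 2) - Complex.sinh (z / 2) * (1 / 2)) /
          (z / 2) ^ 2) z := by
      have h1 : HasDerivAt (fun w : ℂ => w / 2) (1 / 2) z := (hasDerivAt_id z).div_const 2
      have h2 := h1.csinh.div h1 (by simpa using h0)
      refine h2.congr_of_eventuallyEq ?_
      filter_upwards [isOpen_ne.mem_nhds h0] with w hw
      simp [sinhc_of_ne hw]
    rw [hd.deriv, sinhc_of_ne h0]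
    simp only [phiDeriv, h0, if_false]
    field_simp


theorem differentiableOn_phiDeriv : DifferentiableOn ℂ phiDeriv D0 := by
  have h : DifferentiableOn ℂ (fun z => deriv sinhc z / sinhc z) D0 :=
    (differentiable_sinhc.differentiableOn.deriv isOpen_univ |>.mono (Set.subset_univ _)).div
      differentiable_sinhc.differentiableOn fun z hz => sinhc_ne_zero hz
  exact h.congr fun z hz => phiDeriv_eq hz

theorem hasDerivAt_phi {z : ℂ} (hz : z ∈ D0) : HasDerivAt phi (phiDeriv z) z :=
  hasDerivAt_segmentIntegral isOpen_D0 starConvex_D0 differentiableOn_phiDeriv hz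

theorem phi_zero : phi 0 = 0 := by simp [phi]

theorem phiDeriv_neg (z : ℂ) : phiDeriv (-z) = -phiDeriv z := by
  by_cases h0 : z = 0
  · simp [h0, phiDeriv]
  · simp only [phiDeriv, h0, neg_eq_zero, if_false, neg_div, Complex.cosh_neg, Complex.sinh_neg]
    ring

theorem phi_neg (z : ℂ) : phi (-z) = phi z := by
  simp only [phi, mul_neg, phiDeriv_neg, neg_mul, neg_neg]

theorem differentiableOn_phi : DifferentiableOn ℂ phi D0 := fun _ hz =>
  (hasDerivAt_phi hz).differentiableAt.differentiableWithinAt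

theorem exp_phi {z : ℂ} (hz : z ∈ D0) : Complex.exp (phi z) = sinhc z := by
  have hpre : IsPreconnected D0 := (starConvex_D0.isPathConnected zero_mem_D0).isConnected.isPreconnected
  have hder : ∀ w ∈ D0, HasDerivAt (fun w => Complex.exp (-phi w) * sinhc w) 0 w := by
    intro w hw
    have h1 := (hasDerivAt_phi hw).neg.cexp.mul (differentiable_sinhc w).hasDerivAt
    refine h1.congr_deriv ?_
    rw [phiDeriv_eq hw]
    have := sinhc_ne_zero hw
    simp only [Pi.neg_apply]
    field_simp
    ring
  have hc := isOpen_D0.is_const_of_deriv_eq_zero hpre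
    (fun w hw => (hder w hw).differentiableAt.differentiableWithinAt)
    (fun w hw => (hder w hw).deriv) hz zero_mem_D0
  simp only [phi_zero, neg_zero, Complex.exp_zero, sinhc_zero, mul_one] at hc
  rw [Complex.exp_neg, inv_mul_eq_one₀ (Complex.exp_ne_zero _)] at hc
  exact hc

/-! ### Deleting the largest entry of a standard tableau -/

namespace YoungDiagram

/-- The diagram obtained by deleting the last cell of row `s`, when this cell is a corner. -/
def removeCorner (lam : YoungDiagram) (s : ℕ) (hs : lam.rowLen (s + 1) < lam.rowLen s) :
    YoungDiagram where
  cells := lam.cells.erase (s, lam.rowLen s - 1)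
  isLowerSet := by
    rintro ⟨i, j⟩ ⟨i', j'⟩ hle h
    simp only [Prod.mk_le_mk] at hle
    simp only [Finset.coe_erase, Set.mem_sdiff, Finset.mem_coe, mem_cells, Set.mem_singleton_iff,
      Prod.mk.injEq] at h ⊢
    refine ⟨lam.up_left_mem hle.1 hle.2 h.1, ?_⟩
    rintro ⟨rfl, rfl⟩
    rcases hle.1.eq_or_lt with rfl | hlt
    · have := mem_iff_lt_rowLen.1 h.1
      exact h.2 ⟨rfl, by omega⟩
    · have h1 := mem_iff_lt_rowLen.1 (lam.up_left_mem (i1 := i' + 1) hlt hle.2 h.1)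
      omega

variable {lam : YoungDiagram} {s : ℕ}

theorem corner_mem (hs : lam.rowLen (s + 1) < lam.rowLen s) : (s, lam.rowLen s - 1) ∈ lam.cells := by
  rw [mem_cells, mem_iff_lt_rowLen]
  omega

variable (hs : lam.rowLen (s + 1) < lam.rowLen s)

theorem card_removeCorner : (lam.removeCorner s hs).card + 1 = lam.card :=
  Finset.card_erase_add_one (corner_mem hs)

theorem mem_removeCorner {c : ℕ × ℕ} :
    c ∈ (lam.removeCorner s hs).cells ↔ c ∈ lam.cells ∧ c ≠ (s, lam.rowLen s - 1) := by
  simp [removeCorner, and_comm]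

theorem rowLen_removeCorner (i : ℕ) :
    (lam.removeCorner s hs).rowLen i = if i = s then lam.rowLen s - 1 else lam.rowLen i := by
  have h : ∀ j, j < (lam.removeCorner s hs).rowLen i ↔
      j < if i = s then lam.rowLen s - 1 else lam.rowLen i := by
    intro j
    rw [← mem_iff_lt_rowLen, ← mem_cells, mem_removeCorner, mem_cells, mem_iff_lt_rowLen]
    simp only [ne_eq, Prod.mk.injEq]
    split_ifs with h
    · subst h; omega
    · simp [h]
  have h1 := h ((lam.removeCorner s hs).rowLen i)
  have h2 := h (if i = s then lam.rowLen s - 1 else lam.rowLen i)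
  omega

end YoungDiagram

namespace StandardTableau

variable {lam : YoungDiagram}

theorem label_le (T : StandardTableau lam) (c) : T.label c ≤ lam.card := (T.1 c).2

theorem label_inj (T : StandardTableau lam) {c c'} (h : T.label c = T.label c') : c = c' :=
  T.1.injective (Fin.ext (Nat.succ_injective h))

theorem exists_label (T : StandardTableau lam) {i : ℕ} (h1 : 1 ≤ i) (h2 : i ≤ lam.card) :
    ∃ c, T.label c = i := by
  refine ⟨T.1.symm ⟨i - 1, by omega⟩, ?_⟩
  simp only [label, Equiv.apply_symm_apply]
  omega

/-- The largest entry of `T` lies in row `s`. -/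
def LastRow (T : StandardTableau lam) (s : ℕ) : Prop :=
  ∃ c, T.label c = lam.card ∧ c.1.1 = s

/-- The largest entry of `T` lies in a row of index at least `s`. -/
def LastRowGE (T : StandardTableau lam) (s : ℕ) : Prop :=
  ∃ c, T.label c = lam.card ∧ s ≤ c.1.1

theorem isCorner_of_label_eq_card (T : StandardTableau lam) {c} (h : T.label c = lam.card) :
    lam.rowLen (c.1.1 + 1) < lam.rowLen c.1.1 ∧ c.1 = (c.1.1, lam.rowLen c.1.1 - 1) := by
  obtain ⟨⟨i, j⟩, hc⟩ := c
  have hij := YoungDiagram.mem_iff_lt_rowLen.1 (YoungDiagram.mem_cells _ |>.1 hc)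
  have hr : ∀ (c' : ℕ × ℕ) (hc' : c' ∈ lam.cells), ¬ (T.1 ⟨(i, j), hc⟩ < T.1 ⟨c', hc'⟩) := by
    intro c' hc' hlt
    have h1 := T.label_le ⟨c', hc'⟩
    have h2 : (T.1 ⟨(i, j), hc⟩ : ℕ) < T.1 ⟨c', hc'⟩ := hlt
    simp only [label] at h h1
    omega
  have h1 : ¬ (j + 1 < lam.rowLen i) := fun hlt =>
    hr (i, j + 1) (YoungDiagram.mem_iff_lt_rowLen.2 hlt) (T.2.1 _ _ rfl (Nat.lt_succ_self j))
  have h2 : ¬ (j < lam.rowLen (i + 1)) := fun hlt =>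
    hr (i + 1, j) (YoungDiagram.mem_iff_lt_rowLen.2 hlt) (T.2.2 _ _ rfl (Nat.lt_succ_self i))
  simp only [Prod.mk.injEq, true_and]
  omega

open Classical in
theorem maj_eq_sum_range (T : StandardTableau lam) :
    T.maj = ∑ i ∈ Finset.range lam.card, if T.IsDescent i then i else 0 := by
  rw [maj, Finset.sum_filter]
  refine Finset.sum_subset_zero_on_sdiff ?_ ?_ fun _ _ => rfl
  · intro i hi
    simp only [Finset.mem_Icc, Finset.mem_range] at hi ⊢
    omega
  · intro i hi
    simp only [Finset.mem_sdiff, Finset.mem_Icc, Finset.mem_range] at hi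
    have : i = 0 := by omega
    simp [this]

section RemoveCorner

variable {s : ℕ} (hs : lam.rowLen (s + 1) < lam.rowLen s)

/-- The inclusion of the cells of `lam` without a corner into the cells of `lam`. -/
def cellInclusion (c : {c // c ∈ (lam.removeCorner s hs).cells}) : {c // c ∈ lam.cells} :=
  ⟨c.1, ((YoungDiagram.mem_removeCorner hs).1 c.2).1⟩

theorem LastRow.label_corner (hs : lam.rowLen (s + 1) < lam.rowLen s) {T : StandardTableau lam} (hT : T.LastRow s) :
    T.label ⟨_, YoungDiagram.corner_mem hs⟩ = lam.card := by
  obtain ⟨c, hc, rfl⟩ := hT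
  rw [← hc]
  congr 1
  exact Subtype.ext (T.isCorner_of_label_eq_card hc).2.symm

theorem LastRow.label_lt {T : StandardTableau lam} (hT : T.LastRow s)
    (c : {c // c ∈ (lam.removeCorner s hs).cells}) :
    (T.1 (cellInclusion hs c) : ℕ) < (lam.removeCorner s hs).card := by
  have h1 := T.label_le (cellInclusion hs c)
  have h2 : T.label (cellInclusion hs c) ≠ lam.card := by
    rw [← LastRow.label_corner hs hT]
    intro h
    have h3 := congrArg Subtype.val (T.label_inj h)
    exact ((YoungDiagram.mem_removeCorner hs).1 c.2).2 h3
  have h3 := YoungDiagram.card_removeCorner hs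
  simp only [label] at h1 h2
  omega

/-- Deleting the largest entry from a tableau in which it occupies the corner of row `s`. -/
def deleteLast (T : StandardTableau lam) (hT : T.LastRow s) :
    StandardTableau (lam.removeCorner s hs) :=
  ⟨Equiv.ofBijective (fun c => ⟨T.1 (cellInclusion hs c), LastRow.label_lt hs hT c⟩) <| by
    rw [Fintype.bijective_iff_injective_and_card]
    refine ⟨fun c c' h => ?_, by simp [YoungDiagram.card]⟩
    have h1 := T.1.injective (Fin.ext (Fin.mk.inj_iff.1 h))
    exact Subtype.ext (congrArg Subtype.val h1 :),
    fun c c' h1 h2 => T.2.1 (cellInclusion hs c) (cellInclusion hs c') h1 h2,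
    fun c c' h1 h2 => T.2.2 (cellInclusion hs c) (cellInclusion hs c') h1 h2⟩

theorem label_deleteLast (T : StandardTableau lam) (hT : T.LastRow s) (c) :
    (T.deleteLast hs hT).label c = T.label (cellInclusion hs c) := rfl

open Classical in
/-- Adding the largest entry in the corner of row `s`. -/
def addLast (T : StandardTableau (lam.removeCorner s hs)) : StandardTableau lam :=
  ⟨Equiv.ofBijective (fun c => if h : c.1 ∈ (lam.removeCorner s hs).cells then
      ⟨T.1 ⟨c.1, h⟩, (T.1 ⟨c.1, h⟩).2.trans (by rw [← YoungDiagram.card_removeCorner hs]; omega)⟩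
      else ⟨(lam.removeCorner s hs).card, by rw [← YoungDiagram.card_removeCorner hs]; omega⟩) <| by
    rw [Fintype.bijective_iff_injective_and_card]
    refine ⟨fun c c' h => ?_, by simp [YoungDiagram.card]⟩
    dsimp only at h
    split_ifs at h with h1 h2 h2
    · have h3 := T.1.injective (Fin.ext (Fin.mk.inj_iff.1 h))
      exact Subtype.ext (congrArg Subtype.val h3 :)
    · have h3 := Fin.mk.inj_iff.1 h
      have := (T.1 ⟨c.1, h1⟩).2
      omega
    · have h3 := Fin.mk.inj_iff.1 h
      have := (T.1 ⟨c'.1, h2⟩).2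
      omega
    · rw [YoungDiagram.mem_removeCorner] at h1 h2
      simp only [c.2, c'.2, true_and, not_not] at h1 h2
      exact Subtype.ext (h1.trans h2.symm), by
    have key : ∀ c c' : {c // c ∈ lam.cells}, c.1 ≤ c'.1 → c.1 ≠ c'.1 →
        c.1 ∈ (lam.removeCorner s hs).cells := by
      intro c c' hle hne
      by_cases h : c'.1 ∈ (lam.removeCorner s hs).cells
      · exact (lam.removeCorner s hs).isLowerSet hle h
      · rw [YoungDiagram.mem_removeCorner] at h ⊢
        simp only [c'.2, true_and, not_not] at h
        exact ⟨c.2, h ▸ hne⟩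
    constructor
    all_goals
      intro c c' h1 h2
      have h := key c c' (by constructor <;> omega) (by intro h; rw [h] at h2; omega)
      by_cases h' : c'.1 ∈ (lam.removeCorner s hs).cells
      · simp only [Equiv.ofBijective_apply, h, h', dif_pos]
        first | exact T.2.1 ⟨c.1, h⟩ ⟨c'.1, h'⟩ h1 h2 | exact T.2.2 ⟨c.1, h⟩ ⟨c'.1, h'⟩ h1 h2
      · simp only [Equiv.ofBijective_apply, h, h', dif_pos, dif_neg, not_false_iff]
        exact (T.1 ⟨c.1, h⟩).2⟩

theorem label_addLast (T : StandardTableau (lam.removeCorner s hs)) (c) :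
    (T.addLast hs).label (cellInclusion hs c) = T.label c := by
  simp only [label, addLast, Equiv.ofBijective_apply, cellInclusion, c.2, dif_pos]

theorem lastRow_addLast (T : StandardTableau (lam.removeCorner s hs)) :
    (T.addLast hs).LastRow s := by
  refine ⟨⟨_, YoungDiagram.corner_mem hs⟩, ?_, rfl⟩
  have h : ¬ (s, lam.rowLen s - 1) ∈ (lam.removeCorner s hs).cells := by
    rw [YoungDiagram.mem_removeCorner]
    exact fun h => h.2 rfl
  simp only [label, addLast, Equiv.ofBijective_apply, h, dif_neg, not_false_iff]
  exact YoungDiagram.card_removeCorner hs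

theorem ext_label {T T' : StandardTableau lam} (h : ∀ c, T.label c = T'.label c) : T = T' :=
  Subtype.ext (Equiv.ext fun c => Fin.ext (Nat.succ_injective (h c)))

/-- Standard tableaux with largest entry in the corner of row `s` correspond to the standard
tableaux of the diagram without this corner. -/
def lastRowEquiv :
    {T : StandardTableau lam // T.LastRow s} ≃ StandardTableau (lam.removeCorner s hs) where
  toFun T := T.1.deleteLast hs T.2
  invFun T := ⟨T.addLast hs, T.lastRow_addLast hs⟩
  left_inv T := by
    refine Subtype.ext (ext_label fun c => ?_)
    by_cases h : c.1 ∈ (lam.removeCorner s hs).cells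
    · exact label_addLast hs _ ⟨c.1, h⟩
    · rw [YoungDiagram.mem_removeCorner] at h
      simp only [c.2, true_and, not_not] at h
      have hc : c = ⟨_, YoungDiagram.corner_mem hs⟩ := Subtype.ext h
      rw [hc, LastRow.label_corner hs T.2, LastRow.label_corner hs (lastRow_addLast hs _)]
  right_inv T := ext_label fun c => by rw [label_deleteLast, label_addLast]

theorem exists_cellInclusion {T : StandardTableau lam} (hT : T.LastRow s) {c}
    (hc : T.label c < lam.card) : ∃ c', cellInclusion hs c' = c := by
  refine ⟨⟨c.1, (YoungDiagram.mem_removeCorner hs).2 ⟨c.2, fun h => ?_⟩⟩, rfl⟩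
  have h1 := LastRow.label_corner hs hT
  have h2 : c = ⟨_, YoungDiagram.corner_mem hs⟩ := Subtype.ext h
  rw [← h2] at h1
  omega

theorem isDescent_deleteLast {T : StandardTableau lam} (hT : T.LastRow s) {i : ℕ}
    (hi : i < (lam.removeCorner s hs).card) :
    (T.deleteLast hs hT).IsDescent i ↔ T.IsDescent i := by
  have hcard := YoungDiagram.card_removeCorner hs
  constructor
  · rintro ⟨c, c', h1, h2, h3⟩
    exact ⟨cellInclusion hs c, cellInclusion hs c', h1, h2, h3⟩
  · rintro ⟨c, c', h1, h2, h3⟩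
    obtain ⟨d, rfl⟩ := exists_cellInclusion hs hT (c := c) (by omega)
    obtain ⟨d', rfl⟩ := exists_cellInclusion hs hT (c := c') (by omega)
    exact ⟨d, d', h1, h2, h3⟩

theorem isDescent_card_removeCorner {T : StandardTableau lam} (hT : T.LastRow s)
    (h0 : (lam.removeCorner s hs).card ≠ 0) :
    T.IsDescent (lam.removeCorner s hs).card ↔ ¬ (T.deleteLast hs hT).LastRowGE s := by
  have hcard := YoungDiagram.card_removeCorner hs
  have hlab := LastRow.label_corner hs hT
  obtain ⟨d, hd⟩ := (T.deleteLast hs hT).exists_label (Nat.one_le_iff_ne_zero.2 h0) le_rfl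
  constructor
  · rintro ⟨c, c', h1, h2, h3⟩ ⟨e, he, hse⟩
    have h4 := T.label_inj ((label_deleteLast hs T hT e).symm.trans (he.trans h1.symm))
    have h5 := T.label_inj (h2.trans (hcard.trans hlab.symm))
    rw [← h4, h5] at h3
    exact absurd h3 (not_lt.2 hse)
  · intro h
    refine ⟨cellInclusion hs d, ⟨_, YoungDiagram.corner_mem hs⟩, hd, by rw [hlab, hcard], ?_⟩
    by_contra h'
    exact h ⟨d, hd, not_lt.1 h'⟩

open Classical in
theorem pow_maj_deleteLast {R : Type*} [CommRing R] (q : R) {T : StandardTableau lam}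
    (hT : T.LastRow s) :
    q ^ T.maj = q ^ (lam.removeCorner s hs).card * q ^ (T.deleteLast hs hT).maj +
      (1 - q ^ (lam.removeCorner s hs).card) *
        if (T.deleteLast hs hT).LastRowGE s then q ^ (T.deleteLast hs hT).maj else 0 := by
  have hmaj : T.maj = (T.deleteLast hs hT).maj +
      if T.IsDescent (lam.removeCorner s hs).card then (lam.removeCorner s hs).card else 0 := by
    rw [maj_eq_sum_range, maj_eq_sum_range, ← YoungDiagram.card_removeCorner hs,
      Finset.sum_range_succ]
    congr 1
    refine Finset.sum_congr rfl fun i hi => ?_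
    rw [isDescent_deleteLast hs hT (Finset.mem_range.1 hi)]
  rw [hmaj]
  by_cases h0 : (lam.removeCorner s hs).card = 0
  · simp [h0]
  · rw [isDescent_card_removeCorner hs hT h0]
    by_cases h : (T.deleteLast hs hT).LastRowGE s
    · simp only [h, not_true_eq_false, if_false, if_true]; ring
    · simp only [h, not_false_eq_true, if_false, if_true]; ring

end RemoveCorner

end StandardTableau

section MajSums

variable {R : Type*} [CommRing R] (lam : YoungDiagram) (q : R)

/-- The generating function of the major index over the standard tableaux of shape `lam`. -/
def majSum : R := ∑ T : StandardTableau lam, q ^ T.maj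

open Classical in
/-- The part of the generating function of the major index which comes from the tableaux with
largest entry in row `s`. -/
def majSumRow (s : ℕ) : R :=
  ∑ T : StandardTableau lam, if T.LastRow s then q ^ T.maj else 0

open Classical in
/-- The part of the generating function of the major index which comes from the tableaux with
largest entry in a row of index at least `s`. -/
def majSumGE (s : ℕ) : R :=
  ∑ T : StandardTableau lam, if T.LastRowGE s then q ^ T.maj else 0

/-- Deleting the largest entry from the corner of row `s` removes the descent at the next largest
label exactly when the new largest entry lies in a row of index smaller than `s`. -/
theorem majSumRow_of_corner {s : ℕ} (hs : lam.rowLen (s + 1) < lam.rowLen s) :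
    majSumRow lam q s =
      q ^ (lam.removeCorner s hs).card * majSum (lam.removeCorner s hs) q +
        (1 - q ^ (lam.removeCorner s hs).card) * majSumGE (lam.removeCorner s hs) q s := by
  classical
  rw [majSumRow, ← Finset.sum_filter, ← Finset.sum_subtype_eq_sum_filter,
    majSum, majSumGE, Finset.mul_sum, Finset.mul_sum, ← Finset.sum_add_distrib]
  have h1 : (Finset.univ : Finset (StandardTableau lam)).subtype (fun T => T.LastRow s) =
    Finset.univ := by ext; simp
  rw [h1]
  refine Fintype.sum_equiv (StandardTableau.lastRowEquiv hs) _ _ fun T => ?_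
  exact StandardTableau.pow_maj_deleteLast hs q T.2

theorem majSumRow_of_not_corner {s : ℕ} (hs : ¬ lam.rowLen (s + 1) < lam.rowLen s) :
    majSumRow lam q s = 0 := by
  classical
  refine Finset.sum_eq_zero fun T _ => if_neg ?_
  rintro ⟨c, hc, rfl⟩
  exact hs (T.isCorner_of_label_eq_card hc).1

theorem majSumGE_eq_sum {k : ℕ} (hk : lam.colLen 0 ≤ k) (s : ℕ) :
    majSumGE lam q s = ∑ i ∈ Finset.Ico s k, majSumRow lam q i := by
  classical
  simp only [majSumGE, majSumRow]
  rw [Finset.sum_comm]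
  refine Finset.sum_congr rfl fun T _ => ?_
  by_cases h0 : ∃ c, T.label c = lam.card
  · obtain ⟨c, hc⟩ := h0
    have h1 : ∀ i, T.LastRow i ↔ i = c.1.1 := fun i =>
      ⟨fun ⟨d, hd, hi⟩ => by rw [← hi, T.label_inj (hd.trans hc.symm)], fun h => ⟨c, hc, h.symm⟩⟩
    have h2 : T.LastRowGE s ↔ s ≤ c.1.1 :=
      ⟨fun ⟨d, hd, hi⟩ => by rwa [← T.label_inj (hd.trans hc.symm)], fun h => ⟨c, hc, h⟩⟩
    have h3 : c.1.1 < k := by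
      have h4 : (c.1.1, 0) ∈ lam := lam.up_left_mem le_rfl (Nat.zero_le _)
        (YoungDiagram.mem_cells _ |>.1 c.2)
      exact (YoungDiagram.mem_iff_lt_colLen.1 h4).trans_le hk
    simp only [h1, h2, Finset.sum_ite_eq', Finset.mem_Ico, h3, and_true]
  · have h1 : ¬ T.LastRowGE s := fun ⟨c, hc, _⟩ => h0 ⟨c, hc⟩
    have h2 : ∀ i, ¬ T.LastRow i := fun i ⟨c, hc, _⟩ => h0 ⟨c, hc⟩
    simp [h1, h2]

theorem majSumGE_zero (h : lam.card ≠ 0) : majSumGE lam q 0 = majSum lam q := by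
  classical
  refine Finset.sum_congr rfl fun T _ => if_pos ?_
  obtain ⟨c, hc⟩ := T.exists_label (Nat.one_le_iff_ne_zero.2 h) le_rfl
  exact ⟨c, hc, Nat.zero_le _⟩

theorem majSum_of_card_eq_zero (h : lam.card = 0) : majSum lam q = 1 := by
  have he : lam.cells = ∅ := Finset.card_eq_zero.1 h
  have : IsEmpty {c // c ∈ lam.cells} := ⟨fun c => by simpa [he] using c.2⟩
  have hmaj : ∀ T : StandardTableau lam, T.maj = 0 := fun T => by
    classical
    rw [T.maj_eq_sum_range, h, Finset.sum_range_zero]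
  have : Subsingleton (StandardTableau lam) :=
    ⟨fun T T' => StandardTableau.ext_label fun c => isEmptyElim c⟩
  let T₀ : StandardTableau lam :=
    ⟨Fintype.equivOfCardEq (by rw [h]; simp [he]), fun c => isEmptyElim c,
      fun c => isEmptyElim c⟩
  have : Unique (StandardTableau lam) := ⟨⟨T₀⟩, fun T => Subsingleton.elim _ _⟩
  simp only [majSum, hmaj, pow_zero, Finset.sum_const, Finset.card_univ, Fintype.card_unique,
    one_smul]

end MajSums

/-! ### Determinants of `q`-exponentials -/

section QDeterminants

variable {K : Type*} [Field K] (q : K)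

/-- The `q`-Pochhammer symbol `(1 - q) (1 - q²) ⋯ (1 - q ^ m)`. -/
def qPoch (m : ℕ) : K := ∏ i ∈ Finset.range m, (1 - q ^ (i + 1))

variable {q} in
theorem qPoch_ne_zero (hq : ∀ i : ℕ, 1 - q ^ (i + 1) ≠ 0) (m : ℕ) : qPoch q m ≠ 0 :=
  Finset.prod_ne_zero_iff.2 fun i _ => hq i

theorem qPoch_succ (m : ℕ) : qPoch q (m + 1) = qPoch q m * (1 - q ^ (m + 1)) :=
  Finset.prod_range_succ _ _

/-- The quotient `q ^ (j m) / ((1 - q) ⋯ (1 - q ^ m))`. -/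
def qTerm (j m : ℕ) : K := q ^ (j * m) / qPoch q m

/-- The sum of `q ^ u * qTerm q j u` over `u < m`. -/
def qSum (j m : ℕ) : K := ∑ u ∈ Finset.range m, q ^ u * qTerm q j u

theorem qSum_succ (j m : ℕ) : qSum q j (m + 1) = qSum q j m + q ^ m * qTerm q j m :=
  Finset.sum_range_succ _ _

variable {q} in
theorem qSum_zero_left (hq : ∀ i : ℕ, 1 - q ^ (i + 1) ≠ 0) (m : ℕ) :
    qSum q 0 (m + 1) = qTerm q 0 m := by
  induction m with
  | zero => simp [qSum, qTerm]
  | succ m ih =>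
    have h1 := qPoch_ne_zero hq m
    have h2 := hq m
    rw [qSum_succ, ih]
    simp only [qTerm, qPoch_succ, zero_mul, pow_zero]
    field_simp
    ring

variable {q} in
/-- The `q`-analogue of Abel summation which makes the columns of partial sums triangular with
respect to the columns of terms. -/
theorem qSum_succ_left (hq : ∀ i : ℕ, 1 - q ^ (i + 1) ≠ 0) (j m : ℕ) :
    qSum q (j + 1) (m + 1) =
      q ^ (j + 1) * qTerm q (j + 1) m + (1 - q ^ (j + 1)) * qSum q j (m + 1) := by
  induction m with
  | zero => simp [qSum, qTerm, qPoch]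
  | succ m ih =>
    have h1 := qPoch_ne_zero hq m
    have h2 := hq m
    rw [qSum_succ, ih, qSum_succ q j (m + 1)]
    simp only [qTerm, qPoch_succ]
    field_simp
    ring

/-- The determinant with rows `qTerm q · (l i)`. -/
def termDet (k : ℕ) (l : ℕ → ℕ) : K :=
  Matrix.det (Matrix.of fun i j : Fin k => qTerm q j (l i))

/-- The determinant with rows `q ^ (l i) * qTerm q · (l i)` for `i < r` and
`qSum q · (l i + 1)` for `i ≥ r`. -/
def mixedDet (k : ℕ) (l : ℕ → ℕ) (r : ℕ) : K :=
  Matrix.det (Matrix.of fun i j : Fin k =>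
    if (i : ℕ) < r then q ^ l i * qTerm q j (l i) else qSum q j (l i + 1))

/-- The determinant `mixedDet q k l s` with the row of index `s` replaced by `qSum q · (l s)`. -/
def stepDet (k : ℕ) (l : ℕ → ℕ) (s : ℕ) : K :=
  Matrix.det (Matrix.of fun i j : Fin k =>
    if (i : ℕ) < s then q ^ l i * qTerm q j (l i) else
      if (i : ℕ) = s then qSum q j (l i) else qSum q j (l i + 1))

/-- The row of partial sums `qSum q · (l s + 1)` is the last term plus the row `qSum q · (l s)`. -/
theorem mixedDet_eq_add {k s : ℕ} (hs : s < k) (l : ℕ → ℕ) :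
    mixedDet q k l s = mixedDet q k l (s + 1) + stepDet q k l s := by
  let M : Matrix (Fin k) (Fin k) K := Matrix.of fun i j : Fin k =>
    if (i : ℕ) < s then q ^ l i * qTerm q j (l i) else qSum q j (l i + 1)
  have h := Matrix.det_updateRow_add M ⟨s, hs⟩ (fun j => q ^ l s * qTerm q j (l s))
    (fun j => qSum q j (l s))
  have e : ∀ (u : Fin k → K) (i j : Fin k), M.updateRow ⟨s, hs⟩ u i j =
      if (i : ℕ) = s then u j else M i j := by
    intro u i j
    rw [Matrix.updateRow_apply]
    simp only [Fin.ext_iff]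
  unfold mixedDet stepDet
  refine (congrArg _ ?_).trans (h.trans (congrArg₂ _ (congrArg _ ?_) (congrArg _ ?_)))
  all_goals
    ext i j
    rw [e]
    simp only [M, Matrix.of_apply, Pi.add_apply]
    by_cases hi : (i : ℕ) = s
    · simp [hi, qSum_succ, add_comm]
    · have h1 : (i : ℕ) < s + 1 ↔ (i : ℕ) < s := by omega
      simp [hi, h1]

theorem mixedDet_eq_sum {k s : ℕ} (hs : s ≤ k) (l : ℕ → ℕ) :
    mixedDet q k l s = mixedDet q k l k + ∑ i ∈ Finset.Ico s k, stepDet q k l i := by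
  induction hs using Nat.decreasingInduction with
  | self => simp
  | of_succ s hs ih =>
    rw [mixedDet_eq_add q hs, ih, Finset.sum_eq_sum_Ico_succ_bot hs]
    ring

/-- When row `s` ends in a corner, the step is the determinant of the partition without it. -/
theorem stepDet_eq_mixedDet {k s : ℕ} {l l' : ℕ → ℕ} (hs : l s = l' s + 1)
    (h : ∀ i, i ≠ s → l i = l' i) : stepDet q k l s = mixedDet q k l' s := by
  unfold mixedDet stepDet
  congr 1
  ext i j
  simp only [Matrix.of_apply]
  rcases lt_trichotomy (i : ℕ) s with hi | hi | hi
  · simp [hi, h i hi.ne]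
  · simp [hi, hs]
  · simp [hi.not_gt, hi.ne', h i hi.ne']

/-- When rows `s` and `s + 1` of the diagram have the same length, two rows of the step agree. -/
theorem stepDet_eq_zero {k s : ℕ} {l : ℕ → ℕ} (hs : s + 1 < k) (h : l s = l (s + 1) + 1) :
    stepDet q k l s = 0 := by
  refine Matrix.det_zero_of_row_eq (i := ⟨s, by omega⟩) (j := ⟨s + 1, hs⟩) (by simp) ?_
  ext j
  simp [h]

theorem stepDet_last_eq_zero {k : ℕ} {l : ℕ → ℕ} (h : l k = 0) :
    stepDet q (k + 1) l k = 0 :=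
  Matrix.det_eq_zero_of_row_eq_zero (Fin.last k) fun j => by simp [h, qSum]

theorem mixedDet_self (k : ℕ) (l : ℕ → ℕ) :
    mixedDet q k l k = q ^ (∑ i ∈ Finset.range k, l i) * termDet q k l := by
  rw [← Finset.prod_pow_eq_pow_sum, Finset.prod_range, termDet, ← Matrix.det_mul_column]
  simp [mixedDet, Matrix.of_apply]

variable {q} in
theorem mixedDet_zero (hq : ∀ i : ℕ, 1 - q ^ (i + 1) ≠ 0) (k : ℕ) (l : ℕ → ℕ) :
    mixedDet q k l 0 = q ^ (∑ i ∈ Finset.range k, i) * termDet q k l := by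
  rw [← Finset.prod_pow_eq_pow_sum, Finset.prod_range, termDet, ← Matrix.det_mul_row]
  rcases k with _ | k
  · simp [mixedDet]
  · refine Matrix.det_eq_of_forall_col_eq_smul_add_pred (fun j => 1 - q ^ ((j : ℕ) + 1)) ?_ ?_
    · intro i
      simp [qSum_zero_left hq]
    · intro i j
      simp [qSum_succ_left hq]

theorem termDet_eq (k : ℕ) (l : ℕ → ℕ) :
    termDet q k l = (∏ i : Fin k, (qPoch q (l i))⁻¹) *
      ∏ i : Fin k, ∏ j ∈ Finset.Ioi i, (q ^ l j - q ^ l i) := by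
  rw [← Matrix.det_vandermonde, ← Matrix.det_mul_column, termDet]
  congr 1
  ext i j
  simp [qTerm, Matrix.vandermonde_apply, ← pow_mul, div_eq_inv_mul, mul_comm]

variable {q} in
theorem termDet_ne_zero (hq : ∀ i : ℕ, 1 - q ^ (i + 1) ≠ 0) (hq0 : q ≠ 0) {k : ℕ} {l : ℕ → ℕ}
    (hl : ∀ i j, i < j → j < k → l j < l i) : termDet q k l ≠ 0 := by
  rw [termDet_eq]
  refine mul_ne_zero (Finset.prod_ne_zero_iff.2 fun i _ => inv_ne_zero (qPoch_ne_zero hq _))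
    (Finset.prod_ne_zero_iff.2 fun i _ => Finset.prod_ne_zero_iff.2 fun j hj => ?_)
  obtain ⟨d, hd⟩ := Nat.exists_eq_add_of_lt (hl i j (Fin.lt_def.1 (Finset.mem_Ioi.1 hj)) j.2)
  rw [hd, add_assoc, pow_add, ← mul_one_sub]
  exact mul_ne_zero (pow_ne_zero _ hq0) (hq d)

end QDeterminants

/-! ### The generating function of the major index -/

/-- The strictly decreasing sequence `λ_i + k - i`, `1 ≤ i ≤ k`, attached to a partition with at
most `k` parts (the index is shifted to start at `0`). -/
def betaNumber (lam : YoungDiagram) (k i : ℕ) : ℕ := lam.rowLen i + (k - 1 - i)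

theorem YoungDiagram.card_eq_sum_rowLen (lam : YoungDiagram) {k : ℕ} (hk : lam.colLen 0 ≤ k) :
    lam.card = ∑ i ∈ Finset.range k, lam.rowLen i := by
  have h : ∀ c ∈ lam.cells, c.1 ∈ Finset.range k := by
    rintro ⟨i, j⟩ hm
    have h1 : (i, 0) ∈ lam := lam.up_left_mem le_rfl (Nat.zero_le j) hm
    exact Finset.mem_range.2 ((YoungDiagram.mem_iff_lt_colLen.1 h1).trans_le hk)
  rw [YoungDiagram.card, Finset.card_eq_sum_card_fiberwise (f := Prod.fst) h]
  refine Finset.sum_congr rfl fun i _ => ?_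
  rw [YoungDiagram.rowLen_eq_card]
  rfl

theorem YoungDiagram.rowLen_eq_zero (lam : YoungDiagram) {k : ℕ} (hk : lam.colLen 0 ≤ k) :
    lam.rowLen k = 0 := by
  by_contra h
  have h1 := YoungDiagram.mem_iff_lt_colLen.1
    (YoungDiagram.mem_iff_lt_rowLen.2 (Nat.pos_of_ne_zero h))
  omega

theorem sum_betaNumber (lam : YoungDiagram) {k : ℕ} (hk : lam.colLen 0 ≤ k) :
    ∑ i ∈ Finset.range k, betaNumber lam k i = lam.card + ∑ i ∈ Finset.range k, i := by
  rw [lam.card_eq_sum_rowLen hk]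
  simp only [betaNumber, Finset.sum_add_distrib]
  rw [Finset.sum_range_reflect (fun i => i)]

theorem betaNumber_strictAnti (lam : YoungDiagram) {k i j : ℕ} (hij : i < j) (hj : j < k) :
    betaNumber lam k j < betaNumber lam k i := by
  have := lam.rowLen_anti i j hij.le
  simp only [betaNumber]
  omega

theorem YoungDiagram.colLen_removeCorner_le (lam : YoungDiagram) {s : ℕ}
    (hs : lam.rowLen (s + 1) < lam.rowLen s) : (lam.removeCorner s hs).colLen 0 ≤ lam.colLen 0 := by
  by_contra h
  have h1 := YoungDiagram.mem_iff_lt_colLen.2 (not_le.1 h)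
  have h2 := ((YoungDiagram.mem_removeCorner hs).1 ((YoungDiagram.mem_cells _).2 h1)).1
  exact lt_irrefl _ (YoungDiagram.mem_iff_lt_colLen.1 ((YoungDiagram.mem_cells _).1 h2))

section MajFormula

variable {K : Type*} [Field K] {q : K}

/-- The determinantal formula for the generating function of the major index, together with its
refinement by the row of the largest entry. -/
theorem majSum_aux (hq : ∀ i : ℕ, 1 - q ^ (i + 1) ≠ 0) {k : ℕ} (κ : K)
    (hκ : κ * (q ^ (∑ i ∈ Finset.range k, i) * termDet q k (fun i => k - 1 - i)) = 1)
    (n : ℕ) : ∀ lam : YoungDiagram, lam.card = n → lam.colLen 0 ≤ k →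
      majSum lam q = κ * qPoch q n *
        (q ^ (∑ i ∈ Finset.range k, i) * termDet q k (betaNumber lam k)) ∧
      ∀ r ≤ k, (1 - q ^ n) * majSumGE lam q r = κ * qPoch q n *
        (mixedDet q k (betaNumber lam k) r - mixedDet q k (betaNumber lam k) k) := by
  induction n with
  | zero =>
    intro lam hn hk
    have hrow : ∀ i, lam.rowLen i = 0 := by
      intro i
      by_contra h
      have h1 := (YoungDiagram.mem_cells _).2
        (YoungDiagram.mem_iff_lt_rowLen.2 (Nat.pos_of_ne_zero h))
      have h2 : lam.cells = ∅ := Finset.card_eq_zero.1 hn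
      simp [h2] at h1
    have hb : betaNumber lam k = fun i => k - 1 - i := by
      funext i; simp [betaNumber, hrow]
    refine ⟨?_, fun r hr => ?_⟩
    · rw [majSum_of_card_eq_zero lam q hn, hb]
      simp [qPoch, hκ]
    · rw [mixedDet_eq_sum q hr, Finset.sum_eq_zero]
      · simp
      · intro i hi
        rw [Finset.mem_Ico] at hi
        rcases Nat.lt_or_ge (i + 1) k with h | h
        · refine stepDet_eq_zero q h ?_
          rw [hb]; dsimp only; omega
        · obtain rfl : k = i + 1 := by omega
          exact stepDet_last_eq_zero q (by simp [hb])
  | succ n ih =>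
    intro lam hn hk
    have hrow : ∀ s, s < k → (1 - q ^ (n + 1)) * majSumRow lam q s =
        κ * qPoch q (n + 1) * stepDet q k (betaNumber lam k) s := by
      intro s hsk
      by_cases hs : lam.rowLen (s + 1) < lam.rowLen s
      · have hc : (lam.removeCorner s hs).card = n := by
          have := YoungDiagram.card_removeCorner hs
          omega
        have hk' := (lam.colLen_removeCorner_le hs).trans hk
        obtain ⟨h1, h2⟩ := ih _ hc hk'
        rw [majSumRow_of_corner lam q hs, hc, h2 s hsk.le, h1, mixedDet_self,
          sum_betaNumber _ hk', hc, pow_add, qPoch_succ,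
          stepDet_eq_mixedDet q (l' := betaNumber (lam.removeCorner s hs) k)]
        · ring
        · simp only [betaNumber, YoungDiagram.rowLen_removeCorner, if_true]
          omega
        · intro i hi
          simp [betaNumber, YoungDiagram.rowLen_removeCorner, hi]
      · have h0 : stepDet q k (betaNumber lam k) s = 0 := by
          have h1 := lam.rowLen_anti s (s + 1) (Nat.le_succ s)
          rcases Nat.lt_or_ge (s + 1) k with h | h
          · refine stepDet_eq_zero q h ?_
            simp only [betaNumber]; omega
          · obtain rfl : k = s + 1 := by omega
            refine stepDet_last_eq_zero q ?_
            have := lam.rowLen_eq_zero hk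
            simp only [betaNumber]; omega
        rw [majSumRow_of_not_corner lam q hs, h0, mul_zero, mul_zero]
    have hGE : ∀ r ≤ k, (1 - q ^ (n + 1)) * majSumGE lam q r = κ * qPoch q (n + 1) *
        (mixedDet q k (betaNumber lam k) r - mixedDet q k (betaNumber lam k) k) := by
      intro r hr
      rw [majSumGE_eq_sum lam q hk, mixedDet_eq_sum q hr, add_sub_cancel_left, Finset.mul_sum,
        Finset.mul_sum]
      exact Finset.sum_congr rfl fun s hs => hrow s (Finset.mem_Ico.1 hs).2
    refine ⟨mul_left_cancel₀ (hq n) ?_, hGE⟩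
    rw [← majSumGE_zero lam q (by omega), hGE 0 (Nat.zero_le k), mixedDet_zero hq, mixedDet_self,
      sum_betaNumber _ hk, hn, pow_add]
    ring

/-- Stanley's formula for the generating function of the major index, in terms of the numbers
`λ_i + k - i`. -/
theorem majSum_eq (hq : ∀ i : ℕ, 1 - q ^ (i + 1) ≠ 0) (hq0 : q ≠ 0) (lam : YoungDiagram) {k : ℕ}
    (hk : lam.colLen 0 ≤ k) :
    majSum lam q = qPoch q lam.card * termDet q k (betaNumber lam k) /
      termDet q k (fun i => k - 1 - i) := by
  have h0 : termDet q k (fun i => k - 1 - i) ≠ 0 :=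
    termDet_ne_zero hq hq0 fun i j _ _ => by omega
  have h1 : q ^ (∑ i ∈ Finset.range k, i) ≠ 0 := pow_ne_zero _ hq0
  rw [(majSum_aux hq _ (inv_mul_cancel₀ (mul_ne_zero h1 h0)) _ lam rfl hk).1]
  field_simp

end MajFormula

/-! ### From beta numbers to Frobenius coordinates -/

namespace YoungDiagram

variable (lam : YoungDiagram)

/-- The number of diagonal cells of a Young diagram. -/
def diagLen : ℕ := sInf {i | (i, i) ∉ lam}

/-- The number of cells to the right of the diagonal in row `i`. -/
def arm (i : ℕ) : ℕ := lam.rowLen i - i - 1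

/-- The number of cells below the diagonal in column `i`. -/
def leg (i : ℕ) : ℕ := lam.colLen i - i - 1

variable {lam}

theorem diag_mem_iff {i : ℕ} : (i, i) ∈ lam ↔ i < lam.diagLen := by
  have hne : {i | (i, i) ∉ lam}.Nonempty := ⟨lam.rowLen 0, fun h =>
    lt_irrefl _ (mem_iff_lt_rowLen.1 (lam.up_left_mem (Nat.zero_le _) le_rfl h))⟩
  constructor
  · intro h
    by_contra hlt
    exact Nat.sInf_mem hne (lam.up_left_mem (not_lt.1 hlt) (not_lt.1 hlt) h)
  · intro h
    exact not_not.1 (Nat.notMem_of_lt_sInf h)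

theorem lt_rowLen_of_lt_diagLen {i : ℕ} (h : i < lam.diagLen) : i < lam.rowLen i :=
  mem_iff_lt_rowLen.1 (diag_mem_iff.2 h)

theorem lt_colLen_of_lt_diagLen {i : ℕ} (h : i < lam.diagLen) : i < lam.colLen i :=
  mem_iff_lt_colLen.1 (diag_mem_iff.2 h)

theorem diagLen_le_colLen : lam.diagLen ≤ lam.colLen 0 := by
  by_contra h
  have h1 := lt_colLen_of_lt_diagLen (not_le.1 h)
  have h2 := lam.colLen_anti 0 _ (Nat.zero_le (lam.colLen 0))
  omega

/-- The complement of the beta numbers smaller than the number of parts is given by the legs. -/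
theorem sum_betaNumber_tail {M : Type*} [AddCommMonoid M] (F : ℕ → M) :
    ∑ i ∈ Finset.Ico lam.diagLen (lam.colLen 0), F (betaNumber lam (lam.colLen 0) i) +
      ∑ j ∈ Finset.range lam.diagLen, F (lam.colLen 0 - 1 - lam.leg j) =
    ∑ m ∈ Finset.range (lam.colLen 0), F m := by
  have hcol : ∀ j, lam.colLen j ≤ lam.colLen 0 := fun j => lam.colLen_anti 0 j (Nat.zero_le j)
  have hd := diagLen_le_colLen (lam := lam)
  have hinj1 : Set.InjOn (betaNumber lam (lam.colLen 0))
      (Finset.Ico lam.diagLen (lam.colLen 0)) := by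
    intro i hi j hj h
    simp only [Finset.coe_Ico, Set.mem_Ico] at hi hj
    rcases lt_trichotomy i j with hij | hij | hij
    · exact absurd h (betaNumber_strictAnti lam hij hj.2).ne'
    · exact hij
    · exact absurd h (betaNumber_strictAnti lam hij hi.2).ne
  have hinj2 : Set.InjOn (fun j => lam.colLen 0 - 1 - lam.leg j) (Finset.range lam.diagLen) := by
    intro i hi j hj h
    simp only [Finset.coe_range, Set.mem_Iio] at hi hj
    have h1 := lt_colLen_of_lt_diagLen hi
    have h2 := lt_colLen_of_lt_diagLen hj
    have h3 := hcol i
    have h4 := hcol j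
    simp only [leg] at h
    rcases lt_trichotomy i j with hij | hij | hij
    · have := lam.colLen_anti i j hij.le
      omega
    · exact hij
    · have := lam.colLen_anti j i hij.le
      omega
  have hdisj : Disjoint ((Finset.Ico lam.diagLen (lam.colLen 0)).image
      (betaNumber lam (lam.colLen 0)))
      ((Finset.range lam.diagLen).image fun j => lam.colLen 0 - 1 - lam.leg j) := by
    rw [Finset.disjoint_left]
    intro m hm hm'
    obtain ⟨i, hi, rfl⟩ := Finset.mem_image.1 hm
    obtain ⟨j, hj, h⟩ := Finset.mem_image.1 hm'
    rw [Finset.mem_Ico] at hi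
    rw [Finset.mem_range] at hj
    have h2 := lt_colLen_of_lt_diagLen hj
    have h4 := hcol j
    simp only [leg, betaNumber] at h
    by_cases hmem : (i, j) ∈ lam
    · have h5 := mem_iff_lt_rowLen.1 hmem
      have h6 := mem_iff_lt_colLen.1 hmem
      omega
    · have h5 := mt mem_iff_lt_rowLen.2 hmem
      have h6 := mt mem_iff_lt_colLen.2 hmem
      omega
  have hunion : (Finset.Ico lam.diagLen (lam.colLen 0)).image (betaNumber lam (lam.colLen 0)) ∪
      ((Finset.range lam.diagLen).image fun j => lam.colLen 0 - 1 - lam.leg j) =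
      Finset.range (lam.colLen 0) := by
    refine Finset.eq_of_subset_of_card_le ?_ ?_
    · intro m hm
      rw [Finset.mem_union, Finset.mem_image, Finset.mem_image] at hm
      rw [Finset.mem_range]
      rcases hm with ⟨i, hi, rfl⟩ | ⟨j, hj, rfl⟩
      · rw [Finset.mem_Ico] at hi
        have h1 : ¬ i < lam.rowLen i := fun h =>
          absurd (diag_mem_iff.1 (mem_iff_lt_rowLen.2 h)) (not_lt.2 hi.1)
        simp only [betaNumber]
        omega
      · rw [Finset.mem_range] at hj
        omega
    · rw [Finset.card_union_of_disjoint hdisj, Finset.card_image_of_injOn hinj1,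
        Finset.card_image_of_injOn hinj2]
      simp only [Nat.card_Ico, Finset.card_range]
      omega
  rw [← hunion, Finset.sum_union hdisj, Finset.sum_image hinj1, Finset.sum_image hinj2]

theorem sum_betaNumber_eq {M : Type*} [AddCommMonoid M] (F : ℕ → M) :
    ∑ i ∈ Finset.range (lam.colLen 0), F (betaNumber lam (lam.colLen 0) i) +
      ∑ j ∈ Finset.range lam.diagLen, F (lam.colLen 0 - 1 - lam.leg j) =
    ∑ m ∈ Finset.range (lam.colLen 0), F m +
      ∑ i ∈ Finset.range lam.diagLen, F (lam.colLen 0 + lam.arm i) := by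
  have hd := diagLen_le_colLen (lam := lam)
  rw [← sum_betaNumber_tail F, ← Finset.sum_range_add_sum_Ico
    (fun i => F (betaNumber lam (lam.colLen 0) i)) hd]
  have h : ∑ i ∈ Finset.range lam.diagLen, F (betaNumber lam (lam.colLen 0) i) =
      ∑ i ∈ Finset.range lam.diagLen, F (lam.colLen 0 + lam.arm i) := by
    refine Finset.sum_congr rfl fun i hi => ?_
    rw [Finset.mem_range] at hi
    have := lt_rowLen_of_lt_diagLen hi
    congr 1
    simp only [betaNumber, arm]
    omega
  rw [h]
  abel

end YoungDiagram

section Energy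

/-- For a finite family `l` of integers, the sum of `f` over the intervals `1, …, l i` minus half
the sum of `f` over all differences `l i - l j`. For `l` the beta numbers of a partition and `f`
even with `f 0 = 0`, it is, up to a constant, the sum of `f` over the hook lengths. -/
def betaEnergy (f : ℤ → ℂ) (k : ℕ) (l : ℕ → ℕ) : ℂ :=
  ∑ i ∈ Finset.range k, ∑ u ∈ Finset.range (l i), f (u + 1) -
    (1 / 2) * ∑ i ∈ Finset.range k, ∑ j ∈ Finset.range k, f ((l i : ℤ) - l j)

/-- The sum of `f` over the hook lengths of `lam`, in terms of the Frobenius coordinates. -/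
def frobEnergy (f : ℤ → ℂ) (lam : YoungDiagram) : ℂ :=
  ∑ i ∈ Finset.range lam.diagLen,
      (∑ u ∈ Finset.range (lam.arm i), f (u + 1) + ∑ u ∈ Finset.range (lam.leg i), f (u + 1)) +
    ∑ i ∈ Finset.range lam.diagLen, ∑ j ∈ Finset.range lam.diagLen, f (lam.arm i + lam.leg j + 1) -
    (1 / 2) * ∑ i ∈ Finset.range lam.diagLen, ∑ j ∈ Finset.range lam.diagLen,
      (f ((lam.arm i : ℤ) - lam.arm j) + f ((lam.leg i : ℤ) - lam.leg j))

/-- The set of beta numbers is an interval modified by the arms and the legs of the diagonal cells: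
the energy, which is quadratic in the indicator function of this set, is expanded
accordingly. -/
theorem betaEnergy_eq {f : ℤ → ℂ} (hf : ∀ u, f (-u) = f u) (hf0 : f 0 = 0) (lam : YoungDiagram) :
    betaEnergy f (lam.colLen 0) (betaNumber lam (lam.colLen 0)) =
      betaEnergy f (lam.colLen 0) (fun i => lam.colLen 0 - 1 - i) + frobEnergy f lam := by
  set k := lam.colLen 0 with hk
  set d := lam.diagLen with hd
  have hS : ∀ F : ℕ → ℂ, ∑ i ∈ Finset.range k, F (betaNumber lam k i) =
      ∑ m ∈ Finset.range k, F m + ∑ i ∈ Finset.range d, F (k + lam.arm i) -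
        ∑ j ∈ Finset.range d, F (k - 1 - lam.leg j) := fun F =>
    eq_sub_of_add_eq (YoungDiagram.sum_betaNumber_eq F)
  have hrefl : ∀ F : ℕ → ℂ, ∑ i ∈ Finset.range k, F (k - 1 - i) = ∑ m ∈ Finset.range k, F m :=
    fun F => Finset.sum_range_reflect F k
  have hsymm : ∀ u v : ℤ, f (u - v) = f (v - u) := fun u v => by rw [← hf, neg_sub]
  have hleg : ∀ j ∈ Finset.range d, lam.leg j < k := by
    intro j hj
    have h1 := YoungDiagram.lt_colLen_of_lt_diagLen (Finset.mem_range.1 hj)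
    have h2 := lam.colLen_anti 0 j (Nat.zero_le j)
    simp only [YoungDiagram.leg]
    omega
  -- the interaction of an added number, or of a removed one, with the interval
  have hNA : ∀ a : ℕ, ∑ m ∈ Finset.range k, f ((m : ℤ) - ((k + a : ℕ) : ℤ)) =
      ∑ u ∈ Finset.range (k + a), f (u + 1) - ∑ u ∈ Finset.range a, f (u + 1) := by
    intro a
    rw [add_comm k a, Finset.sum_range_add, add_sub_cancel_left, ← Finset.sum_range_reflect]
    refine Finset.sum_congr rfl fun m hm => ?_
    rw [Finset.mem_range] at hm
    rw [hsymm]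
    congr 1
    omega
  have hNR : ∀ b : ℕ, b < k → ∑ m ∈ Finset.range k, f ((m : ℤ) - ((k - 1 - b : ℕ) : ℤ)) =
      ∑ u ∈ Finset.range (k - 1 - b), f (u + 1) + ∑ u ∈ Finset.range b, f (u + 1) := by
    intro b hb
    obtain ⟨p, hp⟩ : ∃ p, k = p + 1 + b := ⟨k - 1 - b, by omega⟩
    have hp' : k - 1 - b = p := by omega
    rw [hp', hp, Finset.sum_range_add, Finset.sum_range_succ, sub_self, hf0, add_zero,
      ← Finset.sum_range_reflect]
    congr 1
    · refine Finset.sum_congr rfl fun m hm => ?_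
      rw [Finset.mem_range] at hm
      rw [hsymm]
      congr 1
      omega
    · refine Finset.sum_congr rfl fun m hm => ?_
      congr 1
      push_cast
      ring
  have hAR : ∀ i, ∀ j ∈ Finset.range d,
      f (((k + lam.arm i : ℕ) : ℤ) - ((k - 1 - lam.leg j : ℕ) : ℤ)) =
        f (lam.arm i + lam.leg j + 1) := by
    intro i j hj
    have := hleg j hj
    congr 1
    omega
  have hRR : ∀ i ∈ Finset.range d, ∀ j ∈ Finset.range d,
      f (((k - 1 - lam.leg i : ℕ) : ℤ) - ((k - 1 - lam.leg j : ℕ) : ℤ)) =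
        f ((lam.leg i : ℤ) - lam.leg j) := by
    intro i hi j hj
    have h1 := hleg j hj
    have h2 := hleg i hi
    rw [hsymm]
    congr 1
    omega
  have hAA : ∀ i j, f (((k + lam.arm i : ℕ) : ℤ) - ((k + lam.arm j : ℕ) : ℤ)) =
      f ((lam.arm i : ℤ) - lam.arm j) := by
    intro i j
    congr 1
    push_cast
    ring
  have hsplit : ∑ i ∈ Finset.range k, ∑ j ∈ Finset.range k,
      f ((betaNumber lam k i : ℤ) - betaNumber lam k j) =
      ∑ m ∈ Finset.range k, ∑ m' ∈ Finset.range k, f ((m : ℤ) - m') +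
      2 * ∑ i ∈ Finset.range d, (∑ u ∈ Finset.range (k + lam.arm i), f (u + 1) -
        ∑ u ∈ Finset.range (lam.arm i), f (u + 1)) -
      2 * ∑ j ∈ Finset.range d, (∑ u ∈ Finset.range (k - 1 - lam.leg j), f (u + 1) +
        ∑ u ∈ Finset.range (lam.leg j), f (u + 1)) -
      2 * ∑ i ∈ Finset.range d, ∑ j ∈ Finset.range d, f (lam.arm i + lam.leg j + 1) +
      ∑ i ∈ Finset.range d, ∑ j ∈ Finset.range d, f ((lam.arm i : ℤ) - lam.arm j) +
      ∑ i ∈ Finset.range d, ∑ j ∈ Finset.range d, f ((lam.leg i : ℤ) - lam.leg j) := by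
    have hNA' : ∑ m ∈ Finset.range k, ∑ i ∈ Finset.range d,
        f ((m : ℤ) - ((k + lam.arm i : ℕ) : ℤ)) =
        ∑ i ∈ Finset.range d, (∑ u ∈ Finset.range (k + lam.arm i), f (u + 1) -
        ∑ u ∈ Finset.range (lam.arm i), f (u + 1)) := by
      rw [Finset.sum_comm]
      exact Finset.sum_congr rfl fun i _ => hNA _
    have hNR' : ∑ m ∈ Finset.range k, ∑ j ∈ Finset.range d,
        f ((m : ℤ) - ((k - 1 - lam.leg j : ℕ) : ℤ)) =
        ∑ j ∈ Finset.range d, (∑ u ∈ Finset.range (k - 1 - lam.leg j), f (u + 1) +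
        ∑ u ∈ Finset.range (lam.leg j), f (u + 1)) := by
      rw [Finset.sum_comm]
      exact Finset.sum_congr rfl fun j hj => hNR _ (hleg j hj)
    have hAN' : ∑ i ∈ Finset.range d, ∑ m ∈ Finset.range k,
        f (((k + lam.arm i : ℕ) : ℤ) - (m : ℤ)) =
        ∑ i ∈ Finset.range d, (∑ u ∈ Finset.range (k + lam.arm i), f (u + 1) -
        ∑ u ∈ Finset.range (lam.arm i), f (u + 1)) := by
      rw [← hNA', Finset.sum_comm]
      exact Finset.sum_congr rfl fun m _ => Finset.sum_congr rfl fun i _ => hsymm _ _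
    have hRN' : ∑ j ∈ Finset.range d, ∑ m ∈ Finset.range k,
        f (((k - 1 - lam.leg j : ℕ) : ℤ) - (m : ℤ)) =
        ∑ j ∈ Finset.range d, (∑ u ∈ Finset.range (k - 1 - lam.leg j), f (u + 1) +
        ∑ u ∈ Finset.range (lam.leg j), f (u + 1)) := by
      rw [← hNR', Finset.sum_comm]
      exact Finset.sum_congr rfl fun m _ => Finset.sum_congr rfl fun i _ => hsymm _ _
    have hAR' : ∑ i ∈ Finset.range d, ∑ j ∈ Finset.range d,
        f (((k + lam.arm i : ℕ) : ℤ) - ((k - 1 - lam.leg j : ℕ) : ℤ)) =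
        ∑ i ∈ Finset.range d, ∑ j ∈ Finset.range d, f (lam.arm i + lam.leg j + 1) :=
      Finset.sum_congr rfl fun i _ => Finset.sum_congr rfl fun j hj => hAR i j hj
    have hRA' : ∑ j ∈ Finset.range d, ∑ i ∈ Finset.range d,
        f (((k - 1 - lam.leg j : ℕ) : ℤ) - ((k + lam.arm i : ℕ) : ℤ)) =
        ∑ i ∈ Finset.range d, ∑ j ∈ Finset.range d, f (lam.arm i + lam.leg j + 1) := by
      rw [← hAR', Finset.sum_comm]
      exact Finset.sum_congr rfl fun m _ => Finset.sum_congr rfl fun i _ => hsymm _ _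
    have hRR' : ∑ i ∈ Finset.range d, ∑ j ∈ Finset.range d,
        f (((k - 1 - lam.leg i : ℕ) : ℤ) - ((k - 1 - lam.leg j : ℕ) : ℤ)) =
        ∑ i ∈ Finset.range d, ∑ j ∈ Finset.range d, f ((lam.leg i : ℤ) - lam.leg j) :=
      Finset.sum_congr rfl fun i hi => Finset.sum_congr rfl fun j hj => hRR i hi j hj
    rw [hS (fun l => ∑ j ∈ Finset.range k, f ((l : ℤ) - betaNumber lam k j))]
    simp only [fun l : ℤ => hS (fun l' => f (l - (l' : ℤ))), Finset.sum_add_distrib,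
      Finset.sum_sub_distrib, hAA]
    simp only [Finset.sum_add_distrib, Finset.sum_sub_distrib] at hNA' hNR' hAN' hRN'
    rw [hNA', hNR', hAN', hRN', hAR', hRA', hRR']
    ring
  unfold betaEnergy frobEnergy
  rw [hsplit, hS (fun l => ∑ u ∈ Finset.range l, f (u + 1)),
    hrefl (fun l => ∑ u ∈ Finset.range l, f (u + 1)),
    hrefl (fun l => ∑ j ∈ Finset.range k, f ((l : ℤ) - ((k - 1 - j : ℕ) : ℤ)))]
  simp only [fun l : ℤ => hrefl (fun l' => f (l - (l' : ℤ)))]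
  simp only [← hd, Finset.sum_add_distrib, Finset.sum_sub_distrib]
  ring

theorem sum_Ioi_eq_half_sum {k : ℕ} (h : Fin k → Fin k → ℂ) (hs : ∀ i j, h i j = h j i)
    (h0 : ∀ i, h i i = 0) :
    ∑ i, ∑ j ∈ Finset.Ioi i, h i j = (1 / 2) * ∑ i, ∑ j, h i j := by
  have h1 : ∀ i, ∑ j, h i j = ∑ j ∈ Finset.Ioi i, h i j + ∑ j ∈ Finset.Iio i, h i j := by
    intro i
    have : (Finset.univ : Finset (Fin k)) = (Finset.Ioi i ∪ Finset.Iio i) ∪ {i} := by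
      ext j
      simp only [Finset.mem_univ, Finset.mem_union, Finset.mem_Ioi, Finset.mem_Iio,
        Finset.mem_singleton, true_iff]
      rcases lt_trichotomy i j with h | h | h <;> simp [h]
    rw [this, Finset.sum_union, Finset.sum_union, Finset.sum_singleton, h0, add_zero]
    · rw [Finset.disjoint_left]
      intro j hj hj'
      exact absurd (Finset.mem_Ioi.1 hj) (Finset.mem_Iio.1 hj').not_gt
    · rw [Finset.disjoint_left]
      intro j hj hj'
      rw [Finset.mem_singleton] at hj'
      simp [hj'] at hj
  have h2 : ∑ i, ∑ j ∈ Finset.Iio i, h i j = ∑ i, ∑ j ∈ Finset.Ioi i, h i j := by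
    rw [Finset.sum_comm' (s' := fun j => Finset.Ioi j) (t' := Finset.univ) (by simp)]
    exact Finset.sum_congr rfl fun i _ => Finset.sum_congr rfl fun j _ => hs _ _
  simp only [h1, Finset.sum_add_distrib, h2]
  ring

end Energy

/-! ### The Laplace transform of the major index -/

/-- On the positive half-line, `F z` is `z ^ m * exp (G z)` up to a non-zero constant and an
exponential `exp (c z)`. -/
def HasExpForm (F : ℝ → ℂ) (m : ℤ) (G : ℝ → ℂ) : Prop :=
  ∃ C c : ℂ, C ≠ 0 ∧ ∀ z : ℝ, 0 < z → F z = C * (z : ℂ) ^ m * Complex.exp (c * z + G z)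

namespace HasExpForm

theorem mul {F F' G G' : ℝ → ℂ} {m m' : ℤ} (h : HasExpForm F m G) (h' : HasExpForm F' m' G') :
    HasExpForm (fun z => F z * F' z) (m + m') (fun z => G z + G' z) := by
  obtain ⟨C, c, hC, h⟩ := h
  obtain ⟨C', c', hC', h'⟩ := h'
  refine ⟨C * C', c + c', mul_ne_zero hC hC', fun z hz => ?_⟩
  have hz' : (z : ℂ) ≠ 0 := Complex.ofReal_ne_zero.2 hz.ne'
  beta_reduce
  rw [h z hz, h' z hz, zpow_add₀ hz',
    show (c + c') * (z : ℂ) + (G z + G' z) = (c * z + G z) + (c' * z + G' z) by ring,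
    Complex.exp_add (c * z + G z)]
  ring

theorem inv {F G : ℝ → ℂ} {m : ℤ} (h : HasExpForm F m G) :
    HasExpForm (fun z => (F z)⁻¹) (-m) (fun z => -G z) := by
  obtain ⟨C, c, hC, h⟩ := h
  refine ⟨C⁻¹, -c, inv_ne_zero hC, fun z hz => ?_⟩
  beta_reduce
  rw [h z hz, mul_inv, mul_inv, zpow_neg, ← Complex.exp_neg]
  congr 2
  ring

theorem one : HasExpForm (fun _ => 1) 0 (fun _ => 0) := ⟨1, 0, one_ne_zero, fun z _ => by simp⟩

theorem prod {ι : Type*} (s : Finset ι) {F G : ι → ℝ → ℂ} {m : ι → ℤ}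
    (h : ∀ i ∈ s, HasExpForm (F i) (m i) (G i)) :
    HasExpForm (fun z => ∏ i ∈ s, F i z) (∑ i ∈ s, m i) (fun z => ∑ i ∈ s, G i z) := by
  classical
  induction s using Finset.induction_on with
  | empty => simpa using one
  | insert a s ha ih =>
    simp only [Finset.prod_insert ha, Finset.sum_insert ha]
    exact (h a (Finset.mem_insert_self a s)).mul
      (ih fun i hi => h i (Finset.mem_insert_of_mem hi))

end HasExpForm

/-- The function `u ↦ φ (u z / n)` on the integers. -/
def scaledPhi (n : ℕ) (z : ℂ) (u : ℤ) : ℂ := phi (((u : ℝ) / (n : ℝ) : ℝ) * z)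

theorem scaledPhi_neg (n : ℕ) (z : ℂ) (u : ℤ) : scaledPhi n z (-u) = scaledPhi n z u := by
  rw [scaledPhi, scaledPhi, ← phi_neg]
  congr 1
  push_cast
  ring

theorem scaledPhi_neg_right (n : ℕ) (z : ℂ) (u : ℤ) : scaledPhi n (-z) u = scaledPhi n z u := by
  rw [scaledPhi, scaledPhi, ← phi_neg, mul_neg, neg_neg]

theorem scaledPhi_zero (n : ℕ) (z : ℂ) : scaledPhi n z 0 = 0 := by
  simp [scaledPhi, phi_zero]

theorem scaledPhi_zero_right (n : ℕ) (u : ℤ) : scaledPhi n 0 u = 0 := by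
  simp [scaledPhi, phi_zero]

section ExpForms

variable {n : ℕ}

theorem exp_div_pow (z : ℝ) (k : ℕ) :
    Complex.exp (z / n) ^ k = Complex.exp ((k * z / n : ℝ)) := by
  rw [← Complex.exp_nat_mul]
  push_cast
  congr 1
  ring

theorem hasExpForm_one_sub_pow (hn : n ≠ 0) (k : ℕ) (hk : k ≠ 0) :
    HasExpForm (fun z => 1 - Complex.exp (z / n) ^ k) 1 (fun z => scaledPhi n z k) := by
  have hn' : (n : ℂ) ≠ 0 := Nat.cast_ne_zero.2 hn
  have hk' : (k : ℂ) ≠ 0 := Nat.cast_ne_zero.2 hk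
  refine ⟨-(k / n), k / (2 * n), neg_ne_zero.2 (div_ne_zero hk' hn'), fun z hz => ?_⟩
  have hz' : (z : ℂ) ≠ 0 := Complex.ofReal_ne_zero.2 hz.ne'
  have hw : ((k * z / n : ℝ) : ℂ) ≠ 0 := by
    push_cast
    exact div_ne_zero (mul_ne_zero hk' hz') hn'
  have h1 : scaledPhi n z k = phi ((k * z / n : ℝ) : ℂ) := by
    rw [scaledPhi]
    congr 1
    push_cast
    ring
  beta_reduce
  rw [exp_div_pow, h1, Complex.exp_add, exp_phi (ofReal_mem_D0 _), sinhc_of_ne hw, Complex.sinh]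
  set w : ℂ := ((k * z / n : ℝ) : ℂ) with hwdef
  have h2 : (k / (2 * n) : ℂ) * z = w / 2 := by
    rw [hwdef]; push_cast; field_simp
  have h3 : (k / n : ℂ) * z = w := by
    rw [hwdef]; push_cast; field_simp
  have h4 : Complex.exp w = Complex.exp (w / 2) * Complex.exp (w / 2) := by
    rw [← Complex.exp_add]; congr 1; ring
  have h5 : Complex.exp (w / 2) * Complex.exp (-(w / 2)) = 1 := by
    rw [← Complex.exp_add, add_neg_cancel, Complex.exp_zero]
  rw [h2, zpow_one, neg_mul, h3, h4]
  field_simp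
  linear_combination (-1 : ℂ) * h5

theorem hasExpForm_qPoch (hn : n ≠ 0) (m : ℕ) :
    HasExpForm (fun z => qPoch (Complex.exp (z / n)) m) m
      (fun z => ∑ u ∈ Finset.range m, scaledPhi n z (u + 1)) := by
  have h := HasExpForm.prod (Finset.range m)
    fun u _ => hasExpForm_one_sub_pow hn (u + 1) u.succ_ne_zero
  simpa [qPoch] using h

theorem hasExpForm_pow_sub_pow (hn : n ≠ 0) {a b : ℕ} (hab : a < b) :
    HasExpForm (fun z => Complex.exp (z / n) ^ a - Complex.exp (z / n) ^ b) 1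
      (fun z => scaledPhi n z ((b : ℤ) - a)) := by
  have h1 : HasExpForm (fun z => Complex.exp (z / n) ^ a) 0 (fun _ => 0) := by
    refine ⟨1, a / n, one_ne_zero, fun z _ => ?_⟩
    beta_reduce
    rw [exp_div_pow]
    simp only [zpow_zero, one_mul, add_zero]
    congr 1
    push_cast
    ring
  have h := h1.mul (hasExpForm_one_sub_pow hn (b - a) (Nat.sub_ne_zero_of_lt hab))
  simp only [zero_add, mul_one_sub, ← pow_add, Nat.add_sub_cancel' hab.le,
    Nat.cast_sub hab.le] at h
  exact h

theorem hasExpForm_termDet (hn : n ≠ 0) {k : ℕ} {l : ℕ → ℕ}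
    (hl : ∀ i j, i < j → j < k → l j < l i) :
    HasExpForm (fun z => termDet (Complex.exp (z / n)) k l)
      (-(∑ i ∈ Finset.range k, (l i : ℤ)) + ∑ i : Fin k, ((Finset.Ioi i).card : ℤ))
      (fun z => -betaEnergy (scaledPhi n z) k l) := by
  have h1 := HasExpForm.prod (Finset.univ : Finset (Fin k))
    fun i _ => (hasExpForm_qPoch hn (l i)).inv
  have h2 := HasExpForm.prod (Finset.univ : Finset (Fin k)) fun i _ =>
    HasExpForm.prod (Finset.Ioi i) fun j hj =>
      hasExpForm_pow_sub_pow hn (hl i j (Fin.lt_def.1 (Finset.mem_Ioi.1 hj)) j.2)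
  have h := h1.mul h2
  simp only [← termDet_eq] at h
  convert h using 2 with z
  · simp [Finset.sum_range]
  · simp
  · rw [sum_Ioi_eq_half_sum (fun i j : Fin k => scaledPhi n z ((l i : ℤ) - l j))
      (fun i j => by rw [← scaledPhi_neg, neg_sub]) (fun i => by simp [scaledPhi_zero])]
    simp only [betaEnergy, Finset.sum_range, Finset.sum_neg_distrib]
    ring

end ExpForms

/-- The logarithm of the Laplace transform of the centered and rescaled major index. -/
def logLaplace (lam : YoungDiagram) (z : ℂ) : ℂ :=
  ∑ u ∈ Finset.range lam.card, scaledPhi lam.card z (u + 1) -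
    frobEnergy (scaledPhi lam.card z) lam

theorem hasExpForm_majSum (lam : YoungDiagram) (hn : lam.card ≠ 0) :
    HasExpForm (fun z => majSum lam (Complex.exp (z / lam.card))) 0
      (fun z => logLaplace lam z) := by
  have h1 := hasExpForm_qPoch hn lam.card
  have h2 := hasExpForm_termDet hn (k := lam.colLen 0) (l := betaNumber lam (lam.colLen 0))
    fun i j hij hj => betaNumber_strictAnti lam hij hj
  have h3 := hasExpForm_termDet hn (k := lam.colLen 0) (l := fun i => lam.colLen 0 - 1 - i)
    fun i j hij hj => by omega
  obtain ⟨C, c, hC, h⟩ := (h1.mul h2).mul h3.inv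
  refine ⟨C, c, hC, fun z hz => ?_⟩
  have hq : ∀ i : ℕ, 1 - Complex.exp (z / lam.card) ^ (i + 1) ≠ 0 := by
    intro i hi
    rw [exp_div_pow, sub_eq_zero, ← Complex.ofReal_exp] at hi
    have h4 : Real.exp ((i + 1 : ℕ) * z / lam.card) = 1 := by exact_mod_cast hi.symm
    rw [Real.exp_eq_one_iff] at h4
    have : 0 < ((i + 1 : ℕ) : ℝ) * z / lam.card := by
      have : 0 < (lam.card : ℝ) := Nat.cast_pos.2 (Nat.pos_of_ne_zero hn)
      positivity
    exact this.ne' h4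
  beta_reduce at h ⊢
  rw [majSum_eq hq (Complex.exp_ne_zero _) lam le_rfl, div_eq_mul_inv, h z hz]
  congr 2
  · congr 1
    have h5 : ∑ i ∈ Finset.range (lam.colLen 0), (betaNumber lam (lam.colLen 0) i : ℤ) =
        lam.card + ∑ i ∈ Finset.range (lam.colLen 0), ((lam.colLen 0 - 1 - i : ℕ) : ℤ) := by
      rw [Finset.sum_range_reflect (fun i => (i : ℤ))]
      have := congrArg (Nat.cast : ℕ → ℤ) (sum_betaNumber lam le_rfl)
      rwa [Nat.cast_add, Nat.cast_sum, Nat.cast_sum] at this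
    rw [h5]
    ring
  · rw [betaEnergy_eq (scaledPhi_neg _ _) (scaledPhi_zero _ _), logLaplace]
    ring

theorem isOpen_halfD0 : IsOpen halfD0 :=
  isOpen_D0.preimage (continuous_const.mul continuous_id)

theorem zero_mem_halfD0 : (0 : ℂ) ∈ halfD0 := by
  simpa [halfD0] using zero_mem_D0

theorem isPreconnected_halfD0 : IsPreconnected halfD0 := by
  have h : StarConvex ℝ 0 halfD0 := by
    rw [starConvex_zero_iff]
    intro z hz a ha0 ha1
    have h1 := starConvex_zero_iff.1 starConvex_D0 hz ha0 ha1
    have e : a • (2 * z) = 2 * (a • z) := by simp only [Complex.real_smul]; ring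
    rwa [e] at h1
  exact (h.isPathConnected zero_mem_halfD0).isConnected.isPreconnected

theorem differentiableOn_scaledPhi {n : ℕ} {u : ℤ} (hu : |u| ≤ 2 * n) :
    DifferentiableOn ℂ (fun z => scaledPhi n z u) halfD0 := by
  refine differentiableOn_phi.comp (differentiableOn_id.const_mul _) fun z hz => ?_
  refine real_mul_mem_D0_of_halfD0 hz ?_
  have h : |(u : ℝ)| ≤ 2 * n := by exact_mod_cast hu
  rw [abs_div, Nat.abs_cast]
  exact div_le_of_le_mul₀ (Nat.cast_nonneg n) zero_le_two h

namespace YoungDiagram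

variable {lam : YoungDiagram}

theorem rowLen_le_card (i : ℕ) : lam.rowLen i ≤ lam.card := by
  rw [rowLen_eq_card]
  exact Finset.card_le_card (Finset.filter_subset _ _)

theorem colLen_le_card (i : ℕ) : lam.colLen i ≤ lam.card := by
  rw [colLen_eq_card]
  exact Finset.card_le_card (Finset.filter_subset _ _)

theorem arm_lt_card {i : ℕ} (hi : i < lam.diagLen) : lam.arm i < lam.card := by
  have h1 := lt_rowLen_of_lt_diagLen hi
  have h2 := rowLen_le_card (lam := lam) i
  simp only [arm]
  omega

theorem leg_lt_card {i : ℕ} (hi : i < lam.diagLen) : lam.leg i < lam.card := by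
  have h1 := lt_colLen_of_lt_diagLen hi
  have h2 := colLen_le_card (lam := lam) i
  simp only [leg]
  omega

end YoungDiagram

theorem differentiableOn_logLaplace (lam : YoungDiagram) :
    DifferentiableOn ℂ (logLaplace lam) halfD0 := by
  have hS : ∀ m : ℕ, m ≤ lam.card → DifferentiableOn ℂ
      (fun z => ∑ u ∈ Finset.range m, scaledPhi lam.card z (u + 1)) halfD0 := by
    intro m hm
    refine DifferentiableOn.fun_sum fun u hu => differentiableOn_scaledPhi ?_
    rw [Finset.mem_range] at hu
    rw [abs_le]
    omega
  unfold logLaplace frobEnergy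
  refine (hS _ le_rfl).sub (((DifferentiableOn.fun_sum fun i hi => ?_).add
    (DifferentiableOn.fun_sum fun i hi => DifferentiableOn.fun_sum fun j hj => ?_)).sub
    (DifferentiableOn.const_mul (DifferentiableOn.fun_sum fun i hi =>
      DifferentiableOn.fun_sum fun j hj => ?_) _))
  all_goals
    rw [Finset.mem_range] at hi
    have h1 := YoungDiagram.arm_lt_card hi
    have h2 := YoungDiagram.leg_lt_card hi
  · exact (hS _ h1.le).add (hS _ h2.le)
  all_goals
    rw [Finset.mem_range] at hj
    have h3 := YoungDiagram.arm_lt_card hj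
    have h4 := YoungDiagram.leg_lt_card hj
  · refine differentiableOn_scaledPhi ?_
    rw [abs_le]
    omega
  · refine (differentiableOn_scaledPhi ?_).add (differentiableOn_scaledPhi ?_)
    all_goals
      rw [abs_le]
      omega

theorem logLaplace_neg (lam : YoungDiagram) (z : ℂ) : logLaplace lam (-z) = logLaplace lam z := by
  have : scaledPhi lam.card (-z) = scaledPhi lam.card z := funext (scaledPhi_neg_right _ _)
  rw [logLaplace, logLaplace, this]

theorem logLaplace_zero (lam : YoungDiagram) : logLaplace lam 0 = 0 := by
  simp [logLaplace, frobEnergy, scaledPhi_zero_right]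

theorem deriv_logLaplace_zero (lam : YoungDiagram) : deriv (logLaplace lam) 0 = 0 := by
  have h := deriv_comp_neg (logLaplace lam) 0
  simp only [logLaplace_neg, neg_zero] at h
  linear_combination h / 2

theorem majSum_exp (lam : YoungDiagram) (z : ℂ) :
    majSum lam (Complex.exp (z / lam.card)) =
      ∑ T : StandardTableau lam, Complex.exp (z * (T.X : ℂ)) := by
  refine Finset.sum_congr rfl fun T _ => ?_
  rw [← Complex.exp_nat_mul, StandardTableau.X]
  push_cast
  congr 1
  ring

/-- The explicit logarithm of the Laplace transform, on the whole of `½ D₀`. -/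
theorem exp_logLaplace (lam : YoungDiagram) (hn : lam.card ≠ 0) {z : ℂ} (hz : z ∈ halfD0) :
    Complex.exp (logLaplace lam z) = centeredLaplace lam z := by
  obtain ⟨C, c, hC, h⟩ := hasExpForm_majSum lam hn
  set M : ℂ → ℂ := fun z => ∑ T : StandardTableau lam, Complex.exp (z * (T.X : ℂ)) with hM
  have hMd : Differentiable ℂ M :=
    Differentiable.fun_sum fun T _ => (differentiable_id.mul_const _).cexp
  have hRd : DifferentiableOn ℂ (fun z => C * Complex.exp (c * z + logLaplace lam z)) halfD0 :=
    (((differentiableOn_id.const_mul c).add (differentiableOn_logLaplace lam)).cexp).const_mul C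
  have hM_eq : Set.EqOn M (fun z => C * Complex.exp (c * z + logLaplace lam z)) halfD0 := by
    have h1 : (1 : ℂ) ∈ halfD0 := by
      have := ofReal_mem_D0 2
      simpa [halfD0] using this
    refine (hMd.differentiableOn.analyticOnNhd isOpen_halfD0).eqOn_of_preconnected_of_frequently_eq
      (hRd.analyticOnNhd isOpen_halfD0) isPreconnected_halfD0 h1 ?_
    have ht : Tendsto (fun x : ℝ => (x : ℂ)) (𝓝[≠] 1) (𝓝[≠] 1) := by
      refine tendsto_nhdsWithin_iff.2 ⟨?_, ?_⟩
      · have := Complex.continuous_ofReal.tendsto 1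
        rw [Complex.ofReal_one] at this
        exact this.mono_left nhdsWithin_le_nhds
      · filter_upwards [self_mem_nhdsWithin] with x hx
        simpa using hx
    have hev : ∀ᶠ x : ℝ in 𝓝[≠] 1,
        M x = C * Complex.exp (c * (x : ℂ) + logLaplace lam x) := by
      filter_upwards [nhdsWithin_le_nhds (Ioi_mem_nhds (zero_lt_one' ℝ))] with x hx
      have := h x hx
      beta_reduce at this
      rw [majSum_exp] at this
      simpa using this
    exact ht.frequently hev.frequently
  have hCcard : (Fintype.card (StandardTableau lam) : ℂ) = C := by
    have := hM_eq zero_mem_halfD0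
    simpa [hM, logLaplace_zero] using this
  -- `logLaplace` is even, so `c` is the expectation of the uncentered variable
  have hc : c = (meanX lam : ℂ) := by
    have h1 : HasDerivAt M (∑ T : StandardTableau lam, (T.X : ℂ)) 0 := by
      refine HasDerivAt.fun_sum fun T _ => ?_
      have := ((hasDerivAt_id (0 : ℂ)).mul_const (T.X : ℂ)).cexp
      simpa using this
    have h2 : HasDerivAt (fun z => C * Complex.exp (c * z + logLaplace lam z)) (C * c) 0 := by
      have h3 : HasDerivAt (logLaplace lam) 0 0 := by
        have h4 := ((differentiableOn_logLaplace lam).differentiableAt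
          (isOpen_halfD0.mem_nhds zero_mem_halfD0)).hasDerivAt
        rwa [deriv_logLaplace_zero] at h4
      have h5 := ((((hasDerivAt_id (0 : ℂ)).const_mul c).add h3).cexp).const_mul C
      simpa [logLaplace_zero] using h5
    have h6 := h1.unique (h2.congr_of_eventuallyEq
      (hM_eq.eventuallyEq_of_mem (isOpen_halfD0.mem_nhds zero_mem_halfD0)))
    have h7 : (meanX lam : ℂ) = (∑ T : StandardTableau lam, (T.X : ℂ)) / C := by
      rw [← hCcard, meanX]
      push_cast
      rfl
    rw [h7, h6, mul_div_cancel_left₀ _ hC]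
  have hcl : centeredLaplace lam z = Complex.exp (-(z * (meanX lam : ℂ))) * M z / C := by
    rw [centeredLaplace, hCcard, hM, Finset.mul_sum]
    congr 1
    refine Finset.sum_congr rfl fun T _ => ?_
    rw [← Complex.exp_add]
    push_cast
    congr 1
    ring
  rw [hcl, hM_eq hz]
  beta_reduce
  rw [hc, Complex.exp_add, mul_comm z, Complex.exp_neg]
  field_simp

/-- Holomorphic logarithms on a connected open set are unique. -/
theorem IsHolomorphicLog.eqOn {U : Set ℂ} (hUo : IsOpen U) (hU : IsPreconnected U) (h0 : 0 ∈ U)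
    {F L L' : ℂ → ℂ} (h : IsHolomorphicLog U F L) (h' : IsHolomorphicLog U F L') :
    Set.EqOn L L' U := by
  have hder : ∀ w ∈ U, HasDerivAt (fun w => L w - L' w) 0 w := by
    intro w hw
    have h1 := (h.1.differentiableAt (hUo.mem_nhds hw)).hasDerivAt
    have h2 := (h'.1.differentiableAt (hUo.mem_nhds hw)).hasDerivAt
    have he : (fun w => Complex.exp (L w)) =ᶠ[𝓝 w] fun w => Complex.exp (L' w) := by
      filter_upwards [hUo.mem_nhds hw] with v hv
      rw [h.2.2 v hv, h'.2.2 v hv]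
    have h3 := h1.cexp.unique (h2.cexp.congr_of_eventuallyEq he)
    rw [he.eq_of_nhds] at h3
    have h4 := mul_left_cancel₀ (Complex.exp_ne_zero _) h3
    refine (h1.sub h2).congr_deriv ?_
    rw [h4, sub_self]
  intro z hz
  have hc := hUo.is_const_of_deriv_eq_zero hU
    (fun w hw => (hder w hw).differentiableAt.differentiableWithinAt)
    (fun w hw => (hder w hw).deriv) hz h0
  rw [h.2.1, h'.2.1, sub_zero] at hc
  exact sub_eq_zero.1 hc

theorem isHolomorphicLog_logLaplace (lam : YoungDiagram) (hn : lam.card ≠ 0) :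
    IsHolomorphicLog halfD0 (centeredLaplace lam) (logLaplace lam) :=
  ⟨differentiableOn_logLaplace lam, logLaplace_zero lam, fun _ hz => exp_logLaplace lam hn hz⟩

/-! ### The functions `Λ` and `Ψ` of a partition -/

namespace YoungDiagram

variable {lam : YoungDiagram}

theorem frobA_eq {i : ℕ} (hi : i < lam.diagLen) : frobA lam i = lam.arm i + 1 / 2 := by
  have h := lt_rowLen_of_lt_diagLen hi
  rw [frobA, if_pos (diag_mem_iff.2 hi), arm, Nat.sub_sub, Nat.cast_sub h]
  push_cast
  ring

theorem frobB_eq {i : ℕ} (hi : i < lam.diagLen) : frobB lam i = lam.leg i + 1 / 2 := by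
  have h := lt_colLen_of_lt_diagLen hi
  rw [frobB, if_pos (diag_mem_iff.2 hi), leg, Nat.sub_sub, Nat.cast_sub h]
  push_cast
  ring

theorem frobA_eq_zero {i : ℕ} (hi : lam.diagLen ≤ i) : frobA lam i = 0 := by
  rw [frobA, if_neg fun h => absurd (diag_mem_iff.1 h) (not_lt.2 hi)]

theorem frobB_eq_zero {i : ℕ} (hi : lam.diagLen ≤ i) : frobB lam i = 0 := by
  rw [frobB, if_neg fun h => absurd (diag_mem_iff.1 h) (not_lt.2 hi)]

theorem sum_frob_diagLen :
    ∑ i ∈ Finset.range lam.diagLen, (frobA lam i + frobB lam i) = lam.card := by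
  rw [← sum_frob]
  refine Finset.sum_subset (fun i hi => ?_) fun i _ hi => ?_
  · rw [Finset.mem_range] at hi ⊢
    exact (lt_rowLen_of_lt_diagLen hi).trans_le (lam.rowLen_anti 0 i (Nat.zero_le i))
  · rw [Finset.mem_range, not_lt] at hi
    rw [frobA_eq_zero hi, frobB_eq_zero hi, add_zero]

end YoungDiagram

section ThomaAtoms

variable (lam : YoungDiagram)

/-- The masses of the atoms of the Thoma measure of a partition, for its positive and its negative
atoms. -/
def atomMass : Fin lam.diagLen ⊕ Fin lam.diagLen → ℝ :=
  Sum.elim (fun i => (thomaOf lam).α i) fun i => (thomaOf lam).β i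

/-- The positions of the atoms of the Thoma measure of a partition. -/
def atomPos : Fin lam.diagLen ⊕ Fin lam.diagLen → ℝ :=
  Sum.elim (fun i => (thomaOf lam).α i) fun i => -(thomaOf lam).β i

variable {lam}

theorem atomMass_nonneg (s) : 0 ≤ atomMass lam s := by
  rcases s with i | i
  · exact (thomaOf lam).α_nonneg i
  · exact (thomaOf lam).β_nonneg i

theorem sum_atomMass (hn : lam.card ≠ 0) : ∑ s, atomMass lam s = 1 := by
  have hn' : (lam.card : ℝ) ≠ 0 := Nat.cast_ne_zero.2 hn
  have h := YoungDiagram.sum_frob_diagLen (lam := lam)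
  rw [Finset.sum_range, Finset.sum_add_distrib] at h
  simp only [Fintype.sum_sum_type, atomMass, Sum.elim_inl, Sum.elim_inr, thomaOf,
    ← Finset.sum_div]
  rw [← add_div, h, div_self hn']

theorem thomaMeasure_eq (hn : lam.card ≠ 0) :
    thomaMeasure (thomaOf lam) =
      Measure.sum fun s => ENNReal.ofReal (atomMass lam s) • Measure.dirac (atomPos lam s) := by
  have hn' : (lam.card : ℝ) ≠ 0 := Nat.cast_ne_zero.2 hn
  have h1 : ∑' i, ((thomaOf lam).α i + (thomaOf lam).β i) = 1 := by
    rw [← div_self hn']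
    exact (hasSum_frob lam).tsum_eq
  have hα : ∀ i, i ∉ Finset.range lam.diagLen → (thomaOf lam).α i = 0 := fun i hi => by
    rw [Finset.mem_range, not_lt] at hi
    simp [thomaOf, YoungDiagram.frobA_eq_zero hi]
  have hβ : ∀ i, i ∉ Finset.range lam.diagLen → (thomaOf lam).β i = 0 := fun i hi => by
    rw [Finset.mem_range, not_lt] at hi
    simp [thomaOf, YoungDiagram.frobB_eq_zero hi]
  ext A hA
  rw [thomaMeasure, h1, sub_self, ENNReal.ofReal_zero, zero_smul, add_zero, Measure.add_apply,
    Measure.sum_apply _ hA, Measure.sum_apply _ hA, Measure.sum_apply _ hA,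
    tsum_fintype (L := .unconditional (Fin lam.diagLen ⊕ Fin lam.diagLen)), Fintype.sum_sum_type,
    tsum_eq_sum (s := Finset.range lam.diagLen) (fun i hi => by simp [hα i hi]),
    tsum_eq_sum (s := Finset.range lam.diagLen) (fun i hi => by simp [hβ i hi]),
    Finset.sum_range, Finset.sum_range]
  rfl

theorem integral_thomaMeasure (hn : lam.card ≠ 0) (f : ℝ → ℂ) :
    ∫ x, f x ∂(thomaMeasure (thomaOf lam)) = ∑ s, (atomMass lam s : ℂ) * f (atomPos lam s) := by
  rw [thomaMeasure_eq hn, integral_sum_dirac_eq_tsum (fun _ => ENNReal.ofReal_ne_top)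
    Summable.of_finite, tsum_fintype]
  simp [ENNReal.toReal_ofReal (atomMass_nonneg _)]

theorem integral_thomaMeasure_prod (hn : lam.card ≠ 0) (f : ℝ × ℝ → ℂ) :
    ∫ p, f p ∂((thomaMeasure (thomaOf lam)).prod (thomaMeasure (thomaOf lam))) =
      ∑ s, ∑ t, (atomMass lam s : ℂ) * atomMass lam t * f (atomPos lam s, atomPos lam t) := by
  have h : (thomaMeasure (thomaOf lam)).prod (thomaMeasure (thomaOf lam)) =
      Measure.sum fun p : (Fin lam.diagLen ⊕ Fin lam.diagLen) × (Fin lam.diagLen ⊕ Fin lam.diagLen) =>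
        ENNReal.ofReal (atomMass lam p.1 * atomMass lam p.2) •
          Measure.dirac (atomPos lam p.1, atomPos lam p.2) := by
    rw [thomaMeasure_eq hn, Measure.prod_sum]
    congr 1
    funext p
    rw [Measure.prod_smul_left, Measure.prod_smul_right, smul_smul, Measure.dirac_prod_dirac,
      ENNReal.ofReal_mul (atomMass_nonneg _)]
  rw [h, integral_sum_dirac_eq_tsum (fun _ => ENNReal.ofReal_ne_top) Summable.of_finite,
    tsum_fintype, Fintype.sum_prod_type]
  simp [ENNReal.toReal_ofReal (mul_nonneg (atomMass_nonneg _) (atomMass_nonneg _))]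

end ThomaAtoms

theorem hasDerivAt_phi_segment {z : ℂ} {t : ℝ} (h : (t : ℂ) * z ∈ D0) :
    HasDerivAt (fun t : ℝ => phi (t * z)) (z * phiDeriv (t * z)) t := by
  have h1 : HasDerivAt (fun t : ℝ => (t : ℂ) * z) z t := by
    simpa using (Complex.ofRealCLM.hasDerivAt (x := t)).mul_const z
  exact ((hasDerivAt_phi h).comp t h1).congr_deriv (mul_comm _ _)

theorem continuousOn_phi_segment {z : ℂ} (hz : z ∈ halfD0) :
    ContinuousOn (fun t : ℝ => phi (t * z)) (Set.Icc (-2) 2) := fun _ ht =>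
  (hasDerivAt_phi_segment
    (real_mul_mem_D0_of_halfD0 hz (abs_le.2 ht))).continuousAt.continuousWithinAt

theorem intervalIntegrable_phi_segment {z : ℂ} (hz : z ∈ halfD0) {a b : ℝ}
    (ha : a ∈ Set.Icc (-2 : ℝ) 2) (hb : b ∈ Set.Icc (-2 : ℝ) 2) :
    IntervalIntegrable (fun t : ℝ => phi (t * z)) volume a b :=
  ((continuousOn_phi_segment hz).mono (Set.uIcc_subset_Icc ha hb)).intervalIntegrable

theorem thomaOf_α_le_one (lam : YoungDiagram) (i : ℕ) : (thomaOf lam).α i ≤ 1 := by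
  have h1 := (thomaOf lam).summable.le_tsum i fun j _ =>
    add_nonneg ((thomaOf lam).α_nonneg j) ((thomaOf lam).β_nonneg j)
  have h2 := (thomaOf lam).tsum_le_one
  have h3 := (thomaOf lam).β_nonneg i
  linarith

theorem thomaOf_β_le_one (lam : YoungDiagram) (i : ℕ) : (thomaOf lam).β i ≤ 1 := by
  have h1 := (thomaOf lam).summable.le_tsum i fun j _ =>
    add_nonneg ((thomaOf lam).α_nonneg j) ((thomaOf lam).β_nonneg j)
  have h2 := (thomaOf lam).tsum_le_one
  have h3 := (thomaOf lam).α_nonneg i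
  linarith

theorem atomMass_le_one (lam : YoungDiagram) (s) : atomMass lam s ≤ 1 := by
  rcases s with i | i
  · exact thomaOf_α_le_one lam i
  · exact thomaOf_β_le_one lam i

theorem phi_mul_atomPos (lam : YoungDiagram) (s) (w : ℂ) :
    phi (atomPos lam s * w) = phi (atomMass lam s * w) := by
  rcases s with i | i
  · rfl
  · rw [← phi_neg]
    simp [atomPos, atomMass]

/-- An atom `x` of the Thoma measure has mass `|x|`, so that `Λ` is a combination of integrals of
`φ` over the segments `[0, x z]`. -/
theorem Lam_thomaOf {lam : YoungDiagram} (hn : lam.card ≠ 0) {z : ℂ} (hz : z ∈ halfD0) :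
    Lam (thomaOf lam) z = (∫ t in (0 : ℝ)..1, phi (t * z)) -
      ∑ i ∈ Finset.range lam.diagLen, ((∫ t in (0 : ℝ)..(thomaOf lam).α i, phi (t * z)) +
        ∫ t in (0 : ℝ)..(thomaOf lam).β i, phi (t * z)) := by
  have hsum : ∑ s, (atomMass lam s : ℂ) = 1 := by exact_mod_cast sum_atomMass hn
  have h1 : ∀ t : ℝ, ∫ x : ℝ, (phi ((t : ℂ) * z) - phi ((t : ℂ) * (x : ℂ) * z))
      ∂(thomaMeasure (thomaOf lam)) =
      phi (t * z) - ∑ s, (atomMass lam s : ℂ) * phi (((t * atomMass lam s : ℝ) : ℂ) * z) := by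
    intro t
    rw [integral_thomaMeasure hn]
    simp only [mul_sub, Finset.sum_sub_distrib]
    rw [← Finset.sum_mul, hsum, one_mul]
    congr 1
    refine Finset.sum_congr rfl fun s _ => ?_
    congr 1
    rw [show (t : ℂ) * atomPos lam s * z = atomPos lam s * (t * z) by ring, phi_mul_atomPos]
    congr 1
    push_cast
    ring
  have hint : IntervalIntegrable (fun t : ℝ => phi (t * z)) volume 0 1 :=
    intervalIntegrable_phi_segment hz (by norm_num) (by norm_num)
  have hints : ∀ s ∈ (Finset.univ : Finset (Fin lam.diagLen ⊕ Fin lam.diagLen)),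
      IntervalIntegrable (fun t : ℝ => (atomMass lam s : ℂ) *
        phi (((t * atomMass lam s : ℝ) : ℂ) * z)) volume 0 1 := by
    intro s _
    refine ContinuousOn.intervalIntegrable (continuousOn_const.mul
      ((continuousOn_phi_segment hz).comp (f := fun t : ℝ => t * atomMass lam s)
        (by fun_prop) fun t ht => ?_))
    rw [Set.uIcc_of_le zero_le_one] at ht
    have h2 := atomMass_nonneg (lam := lam) s
    have h3 := atomMass_le_one lam s
    constructor <;> nlinarith [ht.1, ht.2]
  have hscale : ∀ s, ∫ t in (0 : ℝ)..1, (atomMass lam s : ℂ) *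
      phi (((t * atomMass lam s : ℝ) : ℂ) * z) =
      ∫ t in (0 : ℝ)..atomMass lam s, phi (t * z) := by
    intro s
    have h := intervalIntegral.smul_integral_comp_mul_right (a := 0) (b := 1)
      (fun t : ℝ => phi (t * z)) (atomMass lam s)
    rw [zero_mul, one_mul] at h
    rw [← h, intervalIntegral.integral_const_mul]
    simp
  have hints' : IntervalIntegrable (fun t : ℝ => ∑ s, (atomMass lam s : ℂ) *
      phi (((t * atomMass lam s : ℝ) : ℂ) * z)) volume 0 1 := by
    simpa only [Finset.sum_fn] using IntervalIntegrable.sum _ hints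
  unfold Lam
  simp only [h1]
  rw [intervalIntegral.integral_sub hint hints',
    intervalIntegral.integral_finsetSum hints]
  simp only [hscale, Fintype.sum_sum_type]
  rw [Finset.sum_add_distrib, Finset.sum_range, Finset.sum_range]
  rfl

theorem atomPos_ne_zero {lam : YoungDiagram} (hn : lam.card ≠ 0) (s) : atomPos lam s ≠ 0 := by
  have hn' : (0 : ℝ) < lam.card := Nat.cast_pos.2 (Nat.pos_of_ne_zero hn)
  rcases s with i | i
  · have h : frobA lam i = lam.arm i + 1 / 2 := YoungDiagram.frobA_eq i.2
    have : 0 < frobA lam i := by rw [h]; positivity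
    exact (div_pos this hn').ne'
  · have h : frobB lam i = lam.leg i + 1 / 2 := YoungDiagram.frobB_eq i.2
    have : 0 < frobB lam i := by rw [h]; positivity
    exact neg_ne_zero.2 (div_pos this hn').ne'

theorem Psi_thomaOf {lam : YoungDiagram} (hn : lam.card ≠ 0) (z : ℂ) :
    Psi (thomaOf lam) z = (1 / 2) * phi z -
      ∑ i ∈ Finset.range lam.diagLen, ∑ j ∈ Finset.range lam.diagLen,
        scaledPhi lam.card z (lam.arm i + lam.leg j + 1) +
      (1 / 2) * ∑ i ∈ Finset.range lam.diagLen, ∑ j ∈ Finset.range lam.diagLen,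
        (scaledPhi lam.card z ((lam.arm i : ℤ) - lam.arm j) +
          scaledPhi lam.card z ((lam.leg i : ℤ) - lam.leg j)) := by
  have hn' : (lam.card : ℂ) ≠ 0 := Nat.cast_ne_zero.2 hn
  have hsum : ∑ s, (atomMass lam s : ℂ) = 1 := by exact_mod_cast sum_atomMass hn
  have hker : ∀ s t, psiKernel z (atomPos lam s) (atomPos lam t) =
      (phi (((atomPos lam t : ℂ) - atomPos lam s) * z) - phi (atomMass lam t * z) -
        phi (atomMass lam s * z)) / (atomPos lam s * atomPos lam t) := by
    intro s t
    rw [psiKernel, if_neg (atomPos_ne_zero hn s), if_neg (atomPos_ne_zero hn t), neg_mul,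
      phi_neg, phi_mul_atomPos, phi_mul_atomPos]
  have hα : ∀ i : Fin lam.diagLen, ((thomaOf lam).α i : ℂ) = (lam.arm i + 1 / 2) / lam.card := by
    intro i
    have h : (thomaOf lam).α i = frobA lam i / lam.card := rfl
    rw [h, YoungDiagram.frobA_eq i.2]
    push_cast
    rfl
  have hβ : ∀ i : Fin lam.diagLen, ((thomaOf lam).β i : ℂ) = (lam.leg i + 1 / 2) / lam.card := by
    intro i
    have h : (thomaOf lam).β i = frobB lam i / lam.card := rfl
    rw [h, YoungDiagram.frobB_eq i.2]
    push_cast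
    rfl
  have hα0 : ∀ i : Fin lam.diagLen, ((thomaOf lam).α i : ℂ) ≠ 0 := fun i =>
    Complex.ofReal_ne_zero.2 (atomPos_ne_zero hn (Sum.inl i))
  have hβ0 : ∀ i : Fin lam.diagLen, ((thomaOf lam).β i : ℂ) ≠ 0 := fun i =>
    Complex.ofReal_ne_zero.2 (neg_ne_zero.1 (atomPos_ne_zero hn (Sum.inr i)))
  set A : Fin lam.diagLen → ℂ := fun i => phi ((thomaOf lam).α i * z) with hA
  set B : Fin lam.diagLen → ℂ := fun i => phi ((thomaOf lam).β i * z) with hB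
  have hll : ∀ i j : Fin lam.diagLen, (atomMass lam (Sum.inl i) : ℂ) * atomMass lam (Sum.inl j) *
      psiKernel z (atomPos lam (Sum.inl i)) (atomPos lam (Sum.inl j)) =
      scaledPhi lam.card z ((lam.arm i : ℤ) - lam.arm j) - A j - A i := by
    intro i j
    have e : (((thomaOf lam).α j : ℂ) - (thomaOf lam).α i) * z =
        -(((((lam.arm i : ℤ) - lam.arm j : ℤ) : ℝ) / lam.card : ℝ) * z) := by
      rw [hα, hα]; push_cast; ring
    rw [hker]
    simp only [atomMass, atomPos, Sum.elim_inl]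
    rw [mul_div_cancel₀ _ (mul_ne_zero (hα0 i) (hα0 j)), e, phi_neg]
    rfl
  have hrr : ∀ i j : Fin lam.diagLen, (atomMass lam (Sum.inr i) : ℂ) * atomMass lam (Sum.inr j) *
      psiKernel z (atomPos lam (Sum.inr i)) (atomPos lam (Sum.inr j)) =
      scaledPhi lam.card z ((lam.leg i : ℤ) - lam.leg j) - B j - B i := by
    intro i j
    have e : (((-(thomaOf lam).β j : ℝ) : ℂ) - ((-(thomaOf lam).β i : ℝ) : ℂ)) * z =
        ((((lam.leg i : ℤ) - lam.leg j : ℤ) : ℝ) / lam.card : ℝ) * z := by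
      push_cast; rw [hβ, hβ]; ring
    rw [hker]
    simp only [atomMass, atomPos, Sum.elim_inr]
    rw [e]
    push_cast
    rw [neg_mul_neg, mul_div_cancel₀ _ (mul_ne_zero (hβ0 i) (hβ0 j))]
    simp only [scaledPhi, hB]
    push_cast
    rfl
  have hlr : ∀ i j : Fin lam.diagLen, (atomMass lam (Sum.inl i) : ℂ) * atomMass lam (Sum.inr j) *
      psiKernel z (atomPos lam (Sum.inl i)) (atomPos lam (Sum.inr j)) =
      -(scaledPhi lam.card z (lam.arm i + lam.leg j + 1) - B j - A i) := by
    intro i j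
    have e : (((-(thomaOf lam).β j : ℝ) : ℂ) - ((thomaOf lam).α i : ℂ)) * z =
        -(((((lam.arm i : ℤ) + lam.leg j + 1 : ℤ) : ℝ) / lam.card : ℝ) * z) := by
      push_cast; rw [hα, hβ]; ring
    rw [hker]
    simp only [atomMass, atomPos, Sum.elim_inl, Sum.elim_inr]
    rw [e, phi_neg]
    push_cast
    rw [mul_neg, div_neg, mul_neg, mul_div_cancel₀ _ (mul_ne_zero (hα0 i) (hβ0 j))]
    simp only [scaledPhi, hA, hB]
    push_cast
    rfl
  have hrl : ∀ i j : Fin lam.diagLen, (atomMass lam (Sum.inr i) : ℂ) * atomMass lam (Sum.inl j) *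
      psiKernel z (atomPos lam (Sum.inr i)) (atomPos lam (Sum.inl j)) =
      -(scaledPhi lam.card z (lam.arm j + lam.leg i + 1) - A j - B i) := by
    intro i j
    have e : (((thomaOf lam).α j : ℂ) - ((-(thomaOf lam).β i : ℝ) : ℂ)) * z =
        ((((lam.arm j : ℤ) + lam.leg i + 1 : ℤ) : ℝ) / lam.card : ℝ) * z := by
      push_cast; rw [hα, hβ]; ring
    rw [hker]
    simp only [atomMass, atomPos, Sum.elim_inl, Sum.elim_inr]
    rw [e]
    push_cast
    rw [neg_mul, div_neg, mul_neg, mul_div_cancel₀ _ (mul_ne_zero (hβ0 i) (hα0 j))]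
    simp only [scaledPhi, hA, hB]
    push_cast
    rfl
  have hconst : ∑ s, ∑ t, (atomMass lam s : ℂ) * atomMass lam t * phi z = phi z := by
    simp only [← Finset.sum_mul, ← Finset.mul_sum, hsum, mul_one, one_mul]
  have hcomm : ∑ i : Fin lam.diagLen, ∑ j : Fin lam.diagLen,
      scaledPhi lam.card z (lam.arm j + lam.leg i + 1) =
      ∑ i : Fin lam.diagLen, ∑ j : Fin lam.diagLen,
      scaledPhi lam.card z (lam.arm i + lam.leg j + 1) := Finset.sum_comm
  rw [Psi, integral_thomaMeasure_prod hn]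
  simp only [mul_add, Finset.sum_add_distrib, hconst]
  simp only [Fintype.sum_sum_type, hll, hlr, hrl, hrr, Finset.sum_add_distrib,
    Finset.sum_sub_distrib, Finset.sum_neg_distrib, Finset.sum_const, Finset.sum_range, hcomm,
    ← Finset.smul_sum]
  ring

/-! ### Midpoint quadrature -/

section Quadrature

variable {F F' F'' : ℝ → ℂ} {M : ℝ}

theorem norm_taylor_one_le (hF : ∀ t ∈ Set.Icc (0 : ℝ) 2, HasDerivAt F (F' t) t)
    (hF' : ∀ t ∈ Set.Icc (0 : ℝ) 2, HasDerivAt F' (F'' t) t)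
    (hM : ∀ t ∈ Set.Icc (0 : ℝ) 2, ‖F'' t‖ ≤ M) {c x : ℝ} (hc : c ∈ Set.Icc (0 : ℝ) 2)
    (hx : x ∈ Set.Icc (0 : ℝ) 2) : ‖F x - F c - ((x - c : ℝ) : ℂ) * F' c‖ ≤ M * |x - c| ^ 2 := by
  have hM0 : 0 ≤ M := (norm_nonneg _).trans (hM c hc)
  have hsub : Set.uIcc c x ⊆ Set.Icc 0 2 := Set.uIcc_subset_Icc hc hx
  have h := (convex_uIcc c x).norm_image_sub_le_of_norm_hasDerivWithin_le
    (f := fun y => F y - ((y - c : ℝ) : ℂ) * F' c) (f' := fun y => F' y - F' c)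
    (C := M * |x - c|)
    (fun y hy => by
      have h1 : HasDerivAt (fun y : ℝ => ((y - c : ℝ) : ℂ)) 1 y :=
        ((hasDerivAt_id y).sub_const c).ofReal_comp
      refine (((hF y (hsub hy)).sub (h1.mul_const (F' c))).congr_deriv ?_).hasDerivWithinAt
      rw [one_mul])
    (fun y hy => by
      have h1 := (convex_Icc (0 : ℝ) 2).norm_image_sub_le_of_norm_hasDerivWithin_le
        (fun w hw => (hF' w hw).hasDerivWithinAt) hM hc (hsub hy)
      refine h1.trans (mul_le_mul_of_nonneg_left ?_ hM0)
      rw [Real.norm_eq_abs]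
      exact Set.abs_sub_left_of_mem_uIcc hy)
    Set.left_mem_uIcc Set.right_mem_uIcc
  rw [Real.norm_eq_abs, mul_assoc, ← sq] at h
  refine le_of_eq_of_le ?_ h
  congr 1
  simp only [sub_self, Complex.ofReal_zero, zero_mul, sub_zero]
  ring

theorem norm_integral_sub_midpoint_le (hF : ∀ t ∈ Set.Icc (0 : ℝ) 2, HasDerivAt F (F' t) t)
    (hF' : ∀ t ∈ Set.Icc (0 : ℝ) 2, HasDerivAt F' (F'' t) t)
    (hM : ∀ t ∈ Set.Icc (0 : ℝ) 2, ‖F'' t‖ ≤ M) {c h : ℝ} (hh : 0 ≤ h)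
    (h0 : 0 ≤ c - h) (h2 : c + h ≤ 2) :
    ‖(∫ x in (c - h)..(c + h), F x) - ((2 * h : ℝ) : ℂ) * F c‖ ≤ M * h ^ 2 * (2 * h) := by
  have hM0 : 0 ≤ M := (norm_nonneg _).trans (hM 0 (by norm_num))
  have hsub : Set.uIcc (c - h) (c + h) ⊆ Set.Icc 0 2 :=
    Set.uIcc_subset_Icc ⟨h0, by linarith⟩ ⟨by linarith, h2⟩
  have hFi : IntervalIntegrable F volume (c - h) (c + h) := ContinuousOn.intervalIntegrable
    fun t ht => (hF t (hsub ht)).continuousAt.continuousWithinAt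
  have hci : IntervalIntegrable (fun _ : ℝ => F c) volume (c - h) (c + h) :=
    intervalIntegrable_const
  have hli : IntervalIntegrable (fun x : ℝ => ((x - c : ℝ) : ℂ) * F' c) volume (c - h) (c + h) :=
    Continuous.intervalIntegrable (by fun_prop) _ _
  have hlin : ∫ x in (c - h)..(c + h), ((x - c : ℝ) : ℂ) * F' c = 0 := by
    rw [intervalIntegral.integral_mul_const, intervalIntegral.integral_ofReal,
      intervalIntegral.integral_comp_sub_right (fun x => x)]
    simp
  have e : (∫ x in (c - h)..(c + h), F x) - ((2 * h : ℝ) : ℂ) * F c =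
      ∫ x in (c - h)..(c + h), (F x - F c - ((x - c : ℝ) : ℂ) * F' c) := by
    rw [intervalIntegral.integral_sub (hFi.sub hci) hli, intervalIntegral.integral_sub hFi hci,
      hlin, intervalIntegral.integral_const, sub_zero, Complex.real_smul]
    congr 3
    ring
  rw [e]
  have hb := intervalIntegral.norm_integral_le_of_norm_le_const (a := c - h) (b := c + h)
    (C := M * h ^ 2) (f := fun x => F x - F c - ((x - c : ℝ) : ℂ) * F' c) (fun x hx => by
      have hx' := Set.uIoc_subset_uIcc hx
      refine (norm_taylor_one_le hF hF' hM ⟨by linarith, by linarith⟩ (hsub hx')).trans ?_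
      rw [Set.uIcc_of_le (by linarith)] at hx'
      have h3 : |x - c| ≤ h := abs_le.2 ⟨by linarith [hx'.1], by linarith [hx'.2]⟩
      gcongr)
  rwa [show c + h - (c - h) = 2 * h by ring, abs_of_nonneg (by linarith)] at hb

/-- The Riemann sum of `F` over the multiples of `1 / n` is compared with the integral up to the
next midpoint. There is no first order term because `F` vanishes to second order at `0`. -/
theorem norm_sum_sub_integral_le (hF : ∀ t ∈ Set.Icc (0 : ℝ) 2, HasDerivAt F (F' t) t)
    (hF' : ∀ t ∈ Set.Icc (0 : ℝ) 2, HasDerivAt F' (F'' t) t)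
    (hM : ∀ t ∈ Set.Icc (0 : ℝ) 2, ‖F'' t‖ ≤ M) (hF0 : F 0 = 0) (hF'0 : F' 0 = 0)
    {n : ℕ} (hn : n ≠ 0) {m : ℕ} (hm : m ≤ n) :
    ‖∑ u ∈ Finset.range m, F ((u + 1) / n) - n * ∫ t in (0 : ℝ)..((m + 1 / 2) / n), F t‖ ≤
      M * (m + 1) / n ^ 2 := by
  have hM0 : 0 ≤ M := (norm_nonneg _).trans (hM 0 (by norm_num))
  have hn' : (0 : ℝ) < n := Nat.cast_pos.2 (Nat.pos_of_ne_zero hn)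
  have hn1 : (1 : ℝ) ≤ n := by exact_mod_cast Nat.one_le_iff_ne_zero.2 hn
  have hnc : (n : ℂ) ≠ 0 := Nat.cast_ne_zero.2 hn
  have hint : ∀ a ∈ Set.Icc (0 : ℝ) 2, ∀ b ∈ Set.Icc (0 : ℝ) 2, IntervalIntegrable F volume a b :=
    fun a ha b hb => ContinuousOn.intervalIntegrable fun t ht =>
      (hF t (Set.uIcc_subset_Icc ha hb ht)).continuousAt.continuousWithinAt
  induction m with
  | zero =>
    have hle : (1 / 2 : ℝ) / n ≤ 1 := (div_le_one hn').2 (by linarith)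
    have hpos : (0 : ℝ) ≤ 1 / 2 / n := by positivity
    have hb := intervalIntegral.norm_integral_le_of_norm_le_const (a := 0) (b := 1 / 2 / n)
      (C := M * (1 / 2 / n) ^ 2) (f := F) (fun x hx => by
        rw [Set.uIoc_of_le hpos] at hx
        have h := norm_taylor_one_le hF hF' hM (c := 0) (x := x) (by norm_num)
          ⟨hx.1.le, by linarith [hx.2]⟩
        rw [hF0, hF'0, mul_zero, sub_zero, sub_zero, sub_zero, abs_of_pos hx.1] at h
        exact h.trans (mul_le_mul_of_nonneg_left (pow_le_pow_left₀ hx.1.le hx.2 2) hM0))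
    rw [sub_zero, abs_of_nonneg hpos] at hb
    simp only [Finset.sum_range_zero, Nat.cast_zero, zero_add, zero_sub, norm_neg, norm_mul,
      mul_one, Complex.norm_natCast]
    refine (mul_le_mul_of_nonneg_left hb hn'.le).trans ?_
    rw [show (n : ℝ) * (M * (1 / 2 / n) ^ 2 * (1 / 2 / n)) = M / n ^ 2 / 8 by field_simp; norm_num]
    have : 0 ≤ M / (n : ℝ) ^ 2 := by positivity
    linarith
  | succ m ih =>
    have ih := ih (Nat.le_of_succ_le hm)
    have hmn : (m : ℝ) + 1 ≤ n := by exact_mod_cast hm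
    have hm0 : (0 : ℝ) ≤ m := Nat.cast_nonneg m
    have hc1 : ((m : ℝ) + 1) / n - 1 / 2 / n = (m + 1 / 2) / n := by ring
    have hc2 : ((m : ℝ) + 1) / n + 1 / 2 / n = ((m + 1 : ℕ) + 1 / 2) / n := by push_cast; ring
    have hle : ((m : ℝ) + 1) / n + 1 / 2 / n ≤ 2 := by
      rw [← add_div, div_le_iff₀ hn']
      linarith
    have hge : 0 ≤ ((m : ℝ) + 1) / n - 1 / 2 / n := by rw [hc1]; positivity
    have hmid := norm_integral_sub_midpoint_le hF hF' hM (c := (m + 1) / n) (h := 1 / 2 / n)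
      (by positivity) hge hle
    rw [hc1] at hge
    rw [hc2] at hle
    rw [hc1, hc2] at hmid
    have hadd := intervalIntegral.integral_add_adjacent_intervals
      (hint 0 (by norm_num) ((m + 1 / 2) / n)
        ⟨hge, le_trans (by push_cast; gcongr; linarith) hle⟩)
      (hint ((m + 1 / 2) / n) ⟨hge, le_trans (by push_cast; gcongr; linarith) hle⟩
        (((m + 1 : ℕ) + 1 / 2) / n) ⟨by positivity, hle⟩)
    rw [← hadd, Finset.sum_range_succ]
    set I₁ := ∫ t in (0 : ℝ)..((m + 1 / 2) / n), F t
    set I₂ := ∫ t in ((m + 1 / 2) / n : ℝ)..(((m + 1 : ℕ) + 1 / 2) / n), F t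
    set S := ∑ u ∈ Finset.range m, F ((u + 1) / n)
    have e : S + F ((m + 1) / n) - n * (I₁ + I₂) =
        (S - n * I₁) - n * (I₂ - ((2 * (1 / 2 / n) : ℝ) : ℂ) * F ((m + 1) / n)) := by
      push_cast
      field_simp
      ring
    rw [e]
    refine (norm_sub_le _ _).trans ?_
    rw [norm_mul, Complex.norm_natCast]
    have h3 := mul_le_mul_of_nonneg_left hmid hn'.le
    rw [show (n : ℝ) * (M * (1 / 2 / n) ^ 2 * (2 * (1 / 2 / n))) = M / n ^ 2 / 4 by
      field_simp; norm_num] at h3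
    have h4 : 0 ≤ M / (n : ℝ) ^ 2 := by positivity
    have h5 : M * (((m + 1 : ℕ) : ℝ) + 1) / n ^ 2 = M * (m + 1) / n ^ 2 + M / n ^ 2 := by
      push_cast; ring
    rw [h5]
    linarith

/-- The Euler–Maclaurin formula of order one on `[0, 1]`. -/
theorem norm_sum_sub_integral_sub_half_le
    (hF : ∀ t ∈ Set.Icc (0 : ℝ) 2, HasDerivAt F (F' t) t)
    (hF' : ∀ t ∈ Set.Icc (0 : ℝ) 2, HasDerivAt F' (F'' t) t)
    (hM : ∀ t ∈ Set.Icc (0 : ℝ) 2, ‖F'' t‖ ≤ M) (hF0 : F 0 = 0) (hF'0 : F' 0 = 0)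
    {n : ℕ} (hn : n ≠ 0) :
    ‖∑ u ∈ Finset.range n, F ((u + 1) / n) - n * (∫ t in (0 : ℝ)..1, F t) - 1 / 2 * F 1‖ ≤
      3 * M / n := by
  have hM0 : 0 ≤ M := (norm_nonneg _).trans (hM 0 (by norm_num))
  have hn' : (0 : ℝ) < n := Nat.cast_pos.2 (Nat.pos_of_ne_zero hn)
  have hn1 : (1 : ℝ) ≤ n := by exact_mod_cast Nat.one_le_iff_ne_zero.2 hn
  have hnc : (n : ℂ) ≠ 0 := Nat.cast_ne_zero.2 hn
  have hint : ∀ a ∈ Set.Icc (0 : ℝ) 2, ∀ b ∈ Set.Icc (0 : ℝ) 2, IntervalIntegrable F volume a b :=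
    fun a ha b hb => ContinuousOn.intervalIntegrable fun t ht =>
      (hF t (Set.uIcc_subset_Icc ha hb ht)).continuousAt.continuousWithinAt
  have h1 := norm_sum_sub_integral_le hF hF' hM hF0 hF'0 hn le_rfl
  have hb : ((n : ℝ) + 1 / 2) / n = 1 + 1 / 2 / n := by field_simp
  have hpos : (0 : ℝ) ≤ 1 / 2 / n := by positivity
  have hle : (1 / 2 : ℝ) / n ≤ 1 := (div_le_one hn').2 (by linarith)
  have hadd := intervalIntegral.integral_add_adjacent_intervals
      (hint 0 (by norm_num) 1 (by norm_num))
      (hint 1 (by norm_num) (1 + 1 / 2 / n) ⟨by linarith, by linarith⟩)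
  rw [hb, ← hadd] at h1
  have hF'1 : ∀ x ∈ Set.Icc (0 : ℝ) 2, ‖F' x‖ ≤ 2 * M := by
    intro x hx
    have h := (convex_Icc (0 : ℝ) 2).norm_image_sub_le_of_norm_hasDerivWithin_le
        (fun w hw => (hF' w hw).hasDerivWithinAt) hM (x := 0) (by norm_num) hx
    rw [hF'0, sub_zero, sub_zero, Real.norm_eq_abs, abs_of_nonneg hx.1] at h
    nlinarith [hx.2]
  have h2 : ‖(∫ t in (1 : ℝ)..(1 + 1 / 2 / n), F t) - ((1 / 2 / n : ℝ) : ℂ) * F 1‖ ≤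
      2 * M * (1 / 2 / n) * (1 / 2 / n) := by
    have e : (∫ t in (1 : ℝ)..(1 + 1 / 2 / n), F t) - ((1 / 2 / n : ℝ) : ℂ) * F 1 =
        ∫ t in (1 : ℝ)..(1 + 1 / 2 / n), (F t - F 1) := by
      rw [intervalIntegral.integral_sub (hint 1 (by norm_num) _ ⟨by linarith, by linarith⟩)
        intervalIntegrable_const, intervalIntegral.integral_const, Complex.real_smul,
        add_sub_cancel_left]
    rw [e]
    have h := intervalIntegral.norm_integral_le_of_norm_le_const (a := 1) (b := 1 + 1 / 2 / n)
      (C := 2 * M * (1 / 2 / n)) (f := fun t => F t - F 1) (fun x hx => by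
        rw [Set.uIoc_of_le (by linarith)] at hx
        have h := (convex_Icc (0 : ℝ) 2).norm_image_sub_le_of_norm_hasDerivWithin_le
          (fun w hw => (hF w hw).hasDerivWithinAt) hF'1 (x := 1) (y := x) (by norm_num)
          ⟨by linarith [hx.1], by linarith [hx.2]⟩
        rw [Real.norm_eq_abs, abs_of_pos (by linarith [hx.1])] at h
        exact h.trans (mul_le_mul_of_nonneg_left (by linarith [hx.2]) (by linarith)))
    rwa [add_sub_cancel_left, abs_of_nonneg hpos] at h
  set S := ∑ u ∈ Finset.range n, F ((u + 1) / n)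
  set I := ∫ t in (0 : ℝ)..1, F t
  set J := ∫ t in (1 : ℝ)..(1 + 1 / 2 / n), F t
  have e : S - n * I - 1 / 2 * F 1 =
      (S - n * (I + J)) + n * (J - ((1 / 2 / n : ℝ) : ℂ) * F 1) := by
    push_cast
    field_simp
    ring
  rw [e]
  refine (norm_add_le _ _).trans ?_
  rw [norm_mul, Complex.norm_natCast]
  have h3 := mul_le_mul_of_nonneg_left h2 hn'.le
  rw [show (n : ℝ) * (2 * M * (1 / 2 / n) * (1 / 2 / n)) = M / n / 2 by field_simp] at h3
  have h4 : M * (n + 1) / n ^ 2 ≤ 2 * (M / n) := by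
    rw [show 2 * (M / n) = M * (2 * n) / (n : ℝ) ^ 2 by field_simp]
    gcongr
    linarith
  have h5 : 0 ≤ M / (n : ℝ) := by positivity
  rw [show 3 * M / (n : ℝ) = 3 * (M / n) by ring]
  linarith

end Quadrature

/-! ### The expansion of the Laplace transform -/

/-- The quantitative form of the expansion: `M` bounds the second derivative of `t ↦ φ (t z)`. -/
theorem norm_logLaplace_sub_le {lam : YoungDiagram} (hn : lam.card ≠ 0) {z : ℂ} (hz : z ∈ halfD0)
    {M : ℝ} (hM : ∀ t ∈ Set.Icc (0 : ℝ) 2, ‖z ^ 2 * deriv phiDeriv (t * z)‖ ≤ M) :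
    ‖logLaplace lam z - ((lam.card : ℂ) * Lam (thomaOf lam) z + Psi (thomaOf lam) z)‖ ≤
      5 * M / lam.card := by
  have hM0 : 0 ≤ M := (norm_nonneg _).trans (hM 0 (by norm_num))
  have hn' : (0 : ℝ) < lam.card := Nat.cast_pos.2 (Nat.pos_of_ne_zero hn)
  set n := lam.card with hndef
  set F : ℝ → ℂ := fun t => phi (t * z) with hFdef
  have hmem : ∀ t ∈ Set.Icc (0 : ℝ) 2, (t : ℂ) * z ∈ D0 := fun t ht =>
    real_mul_mem_D0_of_halfD0 hz (by rw [abs_of_nonneg ht.1]; exact ht.2)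
  have hF : ∀ t ∈ Set.Icc (0 : ℝ) 2, HasDerivAt F (z * phiDeriv (t * z)) t := fun t ht =>
    hasDerivAt_phi_segment (hmem t ht)
  have hF' : ∀ t ∈ Set.Icc (0 : ℝ) 2, HasDerivAt (fun t : ℝ => z * phiDeriv (t * z))
      (z ^ 2 * deriv phiDeriv (t * z)) t := by
    intro t ht
    have h1 : HasDerivAt (fun t : ℝ => (t : ℂ) * z) z t := by
      simpa using (Complex.ofRealCLM.hasDerivAt (x := t)).mul_const z
    have h2 := (differentiableOn_phiDeriv.differentiableAt
      (isOpen_D0.mem_nhds (hmem t ht))).hasDerivAt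
    refine ((h2.comp t h1).const_mul z).congr_deriv ?_
    ring
  have hF0 : F 0 = 0 := by simp [hFdef, phi_zero]
  have hF'0 : z * phiDeriv (((0 : ℝ) : ℂ) * z) = 0 := by simp [phiDeriv]
  have hsc : ∀ m : ℕ, ∑ u ∈ Finset.range m, scaledPhi n z (u + 1) =
      ∑ u ∈ Finset.range m, F ((u + 1) / n) := by
    intro m
    refine Finset.sum_congr rfl fun u _ => ?_
    simp only [scaledPhi, hFdef]
    push_cast
    rfl
  have hα : ∀ i ∈ Finset.range lam.diagLen, (thomaOf lam).α i = (lam.arm i + 1 / 2) / n :=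
    fun i hi => by
      rw [← YoungDiagram.frobA_eq (Finset.mem_range.1 hi)]
      rfl
  have hβ : ∀ i ∈ Finset.range lam.diagLen, (thomaOf lam).β i = (lam.leg i + 1 / 2) / n :=
    fun i hi => by
      rw [← YoungDiagram.frobB_eq (Finset.mem_range.1 hi)]
      rfl
  have hLam : Lam (thomaOf lam) z = (∫ t in (0 : ℝ)..1, F t) -
      ∑ i ∈ Finset.range lam.diagLen, ((∫ t in (0 : ℝ)..((lam.arm i + 1 / 2) / n), F t) +
        ∫ t in (0 : ℝ)..((lam.leg i + 1 / 2) / n), F t) := by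
    rw [Lam_thomaOf hn hz]
    congr 1
    refine Finset.sum_congr rfl fun i hi => ?_
    rw [hα i hi, hβ i hi]
  have hF1 : phi z = F 1 := by simp [hFdef]
  -- the double sums over the Frobenius coordinates cancel exactly
  have key : logLaplace lam z - ((n : ℂ) * Lam (thomaOf lam) z + Psi (thomaOf lam) z) =
      (∑ u ∈ Finset.range n, F ((u + 1) / n) - n * (∫ t in (0 : ℝ)..1, F t) - 1 / 2 * F 1) -
      ∑ i ∈ Finset.range lam.diagLen,
        ((∑ u ∈ Finset.range (lam.arm i), F ((u + 1) / n) -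
            n * ∫ t in (0 : ℝ)..((lam.arm i + 1 / 2) / n), F t) +
          (∑ u ∈ Finset.range (lam.leg i), F ((u + 1) / n) -
            n * ∫ t in (0 : ℝ)..((lam.leg i + 1 / 2) / n), F t)) := by
    rw [hLam, Psi_thomaOf hn, logLaplace, frobEnergy, ← hndef]
    simp only [hsc, hF1, Finset.sum_add_distrib, Finset.sum_sub_distrib, ← Finset.mul_sum]
    ring
  rw [key]
  refine (norm_sub_le _ _).trans ?_
  have h1 := norm_sum_sub_integral_sub_half_le hF hF' hM hF0 hF'0 hn
  have h2 : ‖∑ i ∈ Finset.range lam.diagLen,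
        ((∑ u ∈ Finset.range (lam.arm i), F ((u + 1) / n) -
            n * ∫ t in (0 : ℝ)..((lam.arm i + 1 / 2) / n), F t) +
          (∑ u ∈ Finset.range (lam.leg i), F ((u + 1) / n) -
            n * ∫ t in (0 : ℝ)..((lam.leg i + 1 / 2) / n), F t))‖ ≤
      ∑ i ∈ Finset.range lam.diagLen, M / n ^ 2 * (2 * (frobA lam i + frobB lam i)) := by
    refine norm_sum_le_of_le _ fun i hi => (norm_add_le _ _).trans ?_
    rw [Finset.mem_range] at hi
    have h3 := norm_sum_sub_integral_le hF hF' hM hF0 hF'0 hn (YoungDiagram.arm_lt_card hi).le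
    have h4 := norm_sum_sub_integral_le hF hF' hM hF0 hF'0 hn (YoungDiagram.leg_lt_card hi).le
    refine (add_le_add h3 h4).trans ?_
    rw [YoungDiagram.frobA_eq hi, YoungDiagram.frobB_eq hi,
      show M * ((lam.arm i : ℝ) + 1) / lam.card ^ 2 + M * ((lam.leg i : ℝ) + 1) / lam.card ^ 2 =
        M / n ^ 2 * ((lam.arm i : ℝ) + 1 + (lam.leg i + 1)) by ring]
    have h5 : 0 ≤ M / (n : ℝ) ^ 2 := by positivity
    refine mul_le_mul_of_nonneg_left ?_ h5
    have h6 : (0 : ℝ) ≤ lam.arm i := Nat.cast_nonneg _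
    have h7 : (0 : ℝ) ≤ lam.leg i := Nat.cast_nonneg _
    linarith
  rw [← Finset.mul_sum, ← Finset.mul_sum, YoungDiagram.sum_frob_diagLen,
    show M / (n : ℝ) ^ 2 * (2 * n) = 2 * M / n by field_simp] at h2
  refine (add_le_add h1 h2).trans (le_of_eq ?_)
  ring

theorem exists_bound_deriv_phiDeriv {K : Set ℂ} (hK : IsCompact K) (hK' : K ⊆ halfD0) :
    ∃ M : ℝ, ∀ z ∈ K, ∀ t ∈ Set.Icc (0 : ℝ) 2, ‖z ^ 2 * deriv phiDeriv (t * z)‖ ≤ M := by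
  have hc : ContinuousOn (deriv phiDeriv) D0 :=
    (differentiableOn_phiDeriv.deriv isOpen_D0).continuousOn
  have hc' : ContinuousOn (fun p : ℂ × ℝ => p.1 ^ 2 * deriv phiDeriv (p.2 * p.1))
      (K ×ˢ Set.Icc (0 : ℝ) 2) := by
    refine (by fun_prop : ContinuousOn (fun p : ℂ × ℝ => p.1 ^ 2) _).mul
      (hc.comp (f := fun p : ℂ × ℝ => (p.2 : ℂ) * p.1) (by fun_prop) fun p hp => ?_)
    exact real_mul_mem_D0_of_halfD0 (hK' hp.1) (by rw [abs_of_nonneg hp.2.1]; exact hp.2.2)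
  obtain ⟨M, hM⟩ := (hK.prod isCompact_Icc).exists_bound_of_continuousOn hc'
  exact ⟨M, fun z hz t ht => hM (z, t) ⟨hz, ht⟩⟩

theorem theoremA :
    -- the log-Laplace transform exists on `½ D₀`, as a holomorphic branch of the logarithm
    (∀ lam : ℕ → YoungDiagram, IsGrowing lam → ∀ n : ℕ, 1 ≤ n →
      ∃ L : ℂ → ℂ, IsHolomorphicLog halfD0 (centeredLaplace (lam n)) L) ∧
    -- the asymptotic expansion, with a remainder which is uniform in `z` and in the sequence
    (∀ K : Set ℂ, IsCompact K → K ⊆ halfD0 → ∀ ε : ℝ, 0 < ε →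
      ∃ N : ℕ, 1 ≤ N ∧ ∀ lam : ℕ → YoungDiagram, IsGrowing lam → ∀ n : ℕ, N ≤ n →
        ∀ L : ℂ → ℂ, IsHolomorphicLog halfD0 (centeredLaplace (lam n)) L → ∀ z ∈ K,
          ‖L z - ((n : ℂ) * Lam (thomaOf (lam n)) z + Psi (thomaOf (lam n)) z)‖ < ε) := by
  refine ⟨fun lam hlam n hn => ⟨_, isHolomorphicLog_logLaplace (lam n) ?_⟩,
    fun K hK hK' ε hε => ?_⟩
  · rw [hlam n hn]
    exact Nat.one_le_iff_ne_zero.1 hn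
  · obtain ⟨M, hM⟩ := exists_bound_deriv_phiDeriv hK hK'
    obtain ⟨N, hN⟩ := exists_nat_gt (5 * M / ε)
    refine ⟨N + 1, Nat.le_add_left 1 N, fun lam hlam n hn L hL z hz => ?_⟩
    have hcard : (lam n).card = n := hlam n (by omega)
    have hcard0 : (lam n).card ≠ 0 := by omega
    have h1 := hL.eqOn isOpen_halfD0 isPreconnected_halfD0 zero_mem_halfD0
      (isHolomorphicLog_logLaplace (lam n) hcard0) (hK' hz)
    have h2 := norm_logLaplace_sub_le hcard0 (hK' hz) (hM z hz)
    rw [hcard, ← h1] at h2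
    refine h2.trans_lt ?_
    have hNn : (N : ℝ) < n := by exact_mod_cast hn
    rw [div_lt_iff₀ ((Nat.cast_nonneg N).trans_lt hNn), mul_comm ε]
    exact (div_lt_iff₀ hε).1 (hN.trans hNn)

end
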